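/- Let $\mathcal A$ be a finite alphabet and let $\mathcal G$ be a nonempty set of nonempty finite words over $\mathcal A$; write $|g|$ for the length of a word $g$. Let $X_{\rm seq}$ be the set of all $x\in\mathcal A^{\mathbb Z}$ for which there are integers $\cdots<k_{-1}<k_0<k_1<\cdots$ with $x_{k_i}x_{k_i+1}\cdots x_{k_{i+1}-1}\in\mathcal G$ for all $i\in\mathbb Z$, and let the coded shift $X$ be the closure of $X_{\rm seq}$ in the product topology of $\mathcal A^{\mathbb Z}$, with left shift $\sigma$. For a $\sigma$-invariant Borel probability measure $\mu$ on $X$ let $$h_\sigma(\mu)=\lim_{n\to\infty}-\frac1n\sum_{w}\mu([w])\log\mu([w])$$ be its measure-theoretic entropy, where $w$ runs over the words of length $n$ that occur in points of $X$, where $[w]=\{x: x_0\cdots x_{n-1}=w\}$, and where terms with $\mu([w])=0$ are omitted. Let $$h_{\rm seq}(X)=\sup\{h_\sigma(\mu):\ \mu \text{ a } \sigma\text{-invariant Borel probability measure on } X \text{ with } \mu(X_{\rm seq})=1\}.$$ Suppose that $\mathcal G$ uniquely represents $X_{\rm seq}$, i.e. for each $x\in X_{\rm seq}$ the sequence $(k_i)_{i\in\mathbb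 Z}$ above is unique up to enumeration, and that there is an integer $d$ such that $\operatorname{card}\{g\in\mathcal G: |g|=n\}\le d$ for all $n\in\mathbb N$. Then the equation $$\sum_{g\in\mathcal G}\lambda^{-|g|}=1$$ has exactly one solution $\lambda>0$, and $h_{\rm seq}(X)=\log\lambda$ for this $\lambda$. -/

import Mathlib

open Filter MeasureTheory

namespace CodedShift

/-- The left shift on bi-infinite sequences, `(σ x)_i = x_{i+1}`. -/
def shift {A : Type*} (x : ℤ → A) : ℤ → A := fun i => x (i + 1)

/-- The finite word `x[a, b) = x_a x_{a+1} ⋯ x_{b-1}` (used for `a ≤ b`). -/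
def word {A : Type*} (x : ℤ → A) (a b : ℤ) : List A :=
  List.ofFn fun i : Fin (b - a).toNat => x (a + (i : ℤ))

/-- The integers `(k_i)` cut the sequence `x` into a bi-infinite concatenation of words
of `G`: they increase strictly and `x[k_i, k_{i+1}) ∈ G` for all `i`. -/
def IsRepresentation {A : Type*} (G : Set (List A)) (x : ℤ → A) (k : ℤ → ℤ) : Prop :=
  StrictMono k ∧ ∀ i : ℤ, word x (k i) (k (i + 1)) ∈ G

/-- The sequential set: all bi-infinite concatenations of words of `G`. -/
def seqSet {A : Type*} (G : Set (List A)) : Set (ℤ → A) :=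
  {x | ∃ k : ℤ → ℤ, IsRepresentation G x k}

/-- The coded shift generated by `G`: the closure of the sequential set in the product
topology. -/
def codedShift {A : Type*} [TopologicalSpace A] (G : Set (List A)) : Set (ℤ → A) :=
  closure (seqSet G)

/-- `G` uniquely represents its sequential set: up to enumeration, that is, as a set of
cutting points, each point of the sequential set has only one representation. -/
def UniquelyRepresents {A : Type*} (G : Set (List A)) : Prop :=
  ∀ x ∈ seqSet G, ∀ k k' : ℤ → ℤ,
    IsRepresentation G x k → IsRepresentation G x k' → Set.range k = Set.range k'

/-- The words of length `n` that occur in some point of `X`. -/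
def language {A : Type*} (X : Set (ℤ → A)) (n : ℕ) : Set (List A) :=
  {w | ∃ x ∈ X, ∃ a : ℤ, word x a (a + n) = w}

theorem language_finite {A : Type*} [Finite A] (X : Set (ℤ → A)) (n : ℕ) :
    (language X n).Finite := by
  refine (List.finite_length_eq A n).subset ?_
  rintro w ⟨x, -, a, rfl⟩
  simp [word]

/-- The cylinder `[w] = {x : x[0, |w|) = w}`. -/
def cylinder {A : Type*} (w : List A) : Set (ℤ → A) :=
  {x | word x 0 w.length = w}

/-- The Borel probability measures that are invariant under the shift and live on `X`,
viewed as measures on the full shift. -/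
def invariantMeasures {A : Type*} [MeasurableSpace A] (X : Set (ℤ → A)) :
    Set (Measure (ℤ → A)) :=
  {μ | IsProbabilityMeasure μ ∧ MeasurePreserving shift μ μ ∧ μ X = 1}

/-- The measure-theoretic entropy of the shift on `X`,
`lim_n -(1/n) ∑_{w ∈ L(X, n)} μ[w] log μ[w]`, where `0 log 0 = 0`. -/
noncomputable def entropy {A : Type*} [Finite A] [MeasurableSpace A]
    (X : Set (ℤ → A)) (μ : Measure (ℤ → A)) : ℝ :=
  limUnder atTop fun n : ℕ =>
    -(1 / (n : ℝ)) * ∑ w ∈ (language_finite X n).toFinset,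
      μ.real (cylinder w) * Real.log (μ.real (cylinder w))

/-- The sequential entropy: the supremum of the entropies of the invariant probability
measures on the coded shift that give full measure to the sequential set. -/
noncomputable def seqEntropy {A : Type*} [Finite A] [TopologicalSpace A] [MeasurableSpace A]
    (G : Set (List A)) : EReal :=
  ⨆ μ ∈ {μ : Measure (ℤ → A) | μ ∈ invariantMeasures (codedShift G) ∧ μ (seqSet G) = 1},
    ((entropy (codedShift G) μ : ℝ) : EReal)

end CodedShift

namespace CodedShift

/-! ### Shannon entropy of finitely valued maps -/

section Shannon

/-! Put `q = λ⁻¹`. The series `∑ q ^ |g|` vanishes at `0`, is strictly increasing, and converges for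
`q < 1` because there are at most `d` words of each length. With two words it exceeds `1` near `1`,
so it takes the value `1` at a unique `q < 1`. A single word gives `q = 1`.

Upper bound. Splitting off the first code word shows by induction that at most `λ ^ m` words of
length `m` are concatenations of code words (`ncard_concatWords_le`). If an invariant `μ` gives the
sequential set full measure, then for large `L` a window of length `L` at either end of `x[0, n)`
contains a cut with probability close to `1`. Unique representation makes the two cuts part of one
representation, so `x[0, n)` is a concatenation up to two short ends, and there are at most `K λ ^
n` such words. `shannon_le_of_mostly_mem` turns this into `h ≤ log λ` (`entropy_le_log`).

Lower bound. The weights `q ^ |g|` form a probability distribution on `G`. Concatenating independent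
code words and spreading the result over the places of the word at the origin gives a
shift-invariant measure of finite mass, `tower`. By unique representation, a block and the positions
of its outermost cuts determine the code words between them. These have probability `q` to the power
of their total length, and the two partial words at the ends cost only a constant. So cylinders of
length `n` have measure at most `K (n + 1)² q ^ n` (`tower_block_le`), which forces entropy at least
`log λ`. If there is only one word, `log λ = 0` and nonnegativity of entropy suffices. -/

theorem negMulLog_le_of_pos {p q : ℝ} (hp : 0 ≤ p) (hq : 0 < q) :
    Real.negMulLog p ≤ -(p * Real.log q) + q - p := by
  rcases hp.eq_or_lt with rfl | hp
  · simp [hq.le]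
  · have h := Real.log_le_sub_one_of_pos (div_pos hq hp)
    rw [Real.log_div hq.ne' hp.ne'] at h
    have h2 := mul_le_mul_of_nonneg_left h hp.le
    have h3 : p * (q / p - 1) = q - p := by field_simp
    rw [Real.negMulLog]
    linarith [mul_sub p (Real.log q) (Real.log p)]

/-- Gibbs' inequality. -/
theorem sum_negMulLog_le {β : Type*} (s : Finset β) (p q : β → ℝ) (hp : ∀ b ∈ s, 0 ≤ p b)
    (hq : ∀ b ∈ s, 0 ≤ q b) (hpq : ∀ b ∈ s, q b = 0 → p b = 0)
    (hsum : ∑ b ∈ s, q b ≤ ∑ b ∈ s, p b) :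
    ∑ b ∈ s, Real.negMulLog (p b) ≤ ∑ b ∈ s, -(p b * Real.log (q b)) := by
  have : ∑ b ∈ s, Real.negMulLog (p b) ≤ ∑ b ∈ s, (-(p b * Real.log (q b)) + q b - p b) := by
    refine Finset.sum_le_sum fun b hb => ?_
    rcases (hq b hb).eq_or_lt with h | h
    · simp [hpq b hb h.symm, ← h]
    · exact negMulLog_le_of_pos (hp b hb) h
  rw [Finset.sum_sub_distrib, Finset.sum_add_distrib] at this
  linarith

variable {Ω β γ : Type*} [MeasurableSpace Ω]

section

variable [MeasurableSpace β] [MeasurableSingletonClass β] [MeasurableSpace γ]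
  [MeasurableSingletonClass γ]

theorem sum_measureReal_fiber (μ : Measure Ω) [IsFiniteMeasure μ] {f : Ω → β}
    (hf : Measurable f) (s : Finset β) :
    ∑ b ∈ s, μ.real (f ⁻¹' {b}) = μ.real (f ⁻¹' s) :=
  sum_measureReal_preimage_singleton s fun b _ => hf (measurableSet_singleton b)

theorem sum_measureReal_pair_fst [Fintype γ] (μ : Measure Ω) [IsProbabilityMeasure μ] {f : Ω → β} {g : Ω → γ}
    (hf : Measurable f) (hg : Measurable g) (b : β) :
    ∑ c, μ.real ((fun x => (f x, g x)) ⁻¹' {(b, c)}) = μ.real (f ⁻¹' {b}) := by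
  classical
  have h := sum_measureReal_fiber μ (hf.prodMk hg) (({b} : Finset β) ×ˢ Finset.univ)
  rw [Finset.sum_product, Finset.sum_singleton] at h
  rw [h]
  congr 1
  ext x
  simp [eq_comm]

theorem sum_measureReal_pair_snd [Fintype β] (μ : Measure Ω) [IsProbabilityMeasure μ] {f : Ω → β} {g : Ω → γ}
    (hf : Measurable f) (hg : Measurable g) (c : γ) :
    ∑ b, μ.real ((fun x => (f x, g x)) ⁻¹' {(b, c)}) = μ.real (g ⁻¹' {c}) := by
  classical
  have h := sum_measureReal_fiber μ (hf.prodMk hg) (Finset.univ ×ˢ ({c} : Finset γ))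
  rw [Finset.sum_product] at h
  simp only [Finset.sum_singleton] at h
  rw [h]
  congr 1
  ext x
  simp [eq_comm]

end

variable [Fintype β] [Fintype γ]

/-- The Shannon entropy of a map with finitely many values. -/
noncomputable def shannon (μ : Measure Ω) (f : Ω → β) : ℝ :=
  ∑ b, Real.negMulLog (μ.real (f ⁻¹' {b}))

theorem shannon_nonneg (μ : Measure Ω) [IsProbabilityMeasure μ] (f : Ω → β) :
    0 ≤ shannon μ f :=
  Finset.sum_nonneg fun _ _ => Real.negMulLog_nonneg measureReal_nonneg measureReal_le_one

theorem shannon_equiv_comp (μ : Measure Ω) (f : Ω → β) (e : β ≃ γ) :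
    shannon μ (fun x => e (f x)) = shannon μ f := by
  rw [shannon, ← e.sum_comp, shannon]
  refine Finset.sum_congr rfl fun b _ => ?_
  congr 3
  ext x
  simp

variable [MeasurableSpace β] [MeasurableSingletonClass β] [MeasurableSpace γ]
  [MeasurableSingletonClass γ]

theorem sum_measureReal_fiber_univ (μ : Measure Ω) [IsProbabilityMeasure μ] {f : Ω → β}
    (hf : Measurable f) : ∑ b, μ.real (f ⁻¹' {b}) = 1 := by
  rw [sum_measureReal_fiber μ hf]; simp

/-- Gibbs' inequality, comparing the joint law with the product of its marginals. -/
theorem shannon_pair_le (μ : Measure Ω) [IsProbabilityMeasure μ] {f : Ω → β} {g : Ω → γ}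
    (hf : Measurable f) (hg : Measurable g) :
    shannon μ (fun x => (f x, g x)) ≤ shannon μ f + shannon μ g := by
  set p : β × γ → ℝ := fun bc => μ.real ((fun x => (f x, g x)) ⁻¹' {bc}) with hp
  set pf : β → ℝ := fun b => μ.real (f ⁻¹' {b}) with hpf
  set pg : γ → ℝ := fun b => μ.real (g ⁻¹' {b}) with hpg
  have h0f : ∀ bc, pf bc.1 = 0 → p bc = 0 := fun bc h =>
    le_antisymm (h ▸ measureReal_mono (by rintro x rfl; rfl)) measureReal_nonneg
  have h0g : ∀ bc, pg bc.2 = 0 → p bc = 0 := fun bc h =>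
    le_antisymm (h ▸ measureReal_mono (by rintro x rfl; rfl)) measureReal_nonneg
  have key := sum_negMulLog_le Finset.univ p (fun bc => pf bc.1 * pg bc.2)
    (fun _ _ => measureReal_nonneg) (fun _ _ => mul_nonneg measureReal_nonneg measureReal_nonneg)
    (fun bc _ h => (mul_eq_zero.1 h).elim (h0f bc) (h0g bc)) (by
      rw [sum_measureReal_fiber_univ μ (hf.prodMk hg), Fintype.sum_prod_type]
      simp only
      rw [← Finset.sum_mul_sum, sum_measureReal_fiber_univ μ hf, sum_measureReal_fiber_univ μ hg]
      norm_num)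
  refine key.trans_eq ?_
  have : ∀ bc, -(p bc * Real.log (pf bc.1 * pg bc.2))
      = -(p bc * Real.log (pf bc.1)) + -(p bc * Real.log (pg bc.2)) := by
    intro bc
    by_cases h1 : pf bc.1 = 0
    · simp [h0f bc h1]
    by_cases h2 : pg bc.2 = 0
    · simp [h0g bc h2]
    rw [Real.log_mul h1 h2]; ring
  simp only [this]
  rw [Finset.sum_add_distrib]
  congr 1
  · rw [Fintype.sum_prod_type, shannon]
    refine Finset.sum_congr rfl fun b _ => ?_
    simp only [← neg_mul]
    rw [← Finset.sum_mul, Finset.sum_neg_distrib, sum_measureReal_pair_fst μ hf hg, Real.negMulLog]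
  · rw [Fintype.sum_prod_type_right, shannon]
    refine Finset.sum_congr rfl fun b _ => ?_
    simp only [← neg_mul]
    rw [← Finset.sum_mul, Finset.sum_neg_distrib, sum_measureReal_pair_snd μ hf hg, Real.negMulLog]

/-- If `f` lies in `s` outside of an event of probability `ε`, its entropy is at most
`log 2 + log |s| + ε log |β|`. -/
theorem shannon_le_of_mostly_mem (μ : Measure Ω) [IsProbabilityMeasure μ] {f : Ω → β}
    (hf : Measurable f) (s : Finset β) {N : ℝ} (hN1 : 1 ≤ N) (hN : (s.card : ℝ) ≤ N) :
    shannon μ f ≤ Real.log 2 + Real.log N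
      + μ.real (f ⁻¹' s)ᶜ * Real.log (Fintype.card β) := by
  classical
  have : Nonempty Ω := by
    by_contra h
    rw [not_nonempty_iff] at h
    have := measure_univ (μ := μ)
    simp [Set.univ_eq_empty_iff.2 h] at this
  have : Nonempty β := this.map f
  set B : ℝ := (Fintype.card β : ℝ) with hB
  have hB1 : 1 ≤ B := by rw [hB]; exact_mod_cast Fintype.card_pos
  set p : β → ℝ := fun b => μ.real (f ⁻¹' {b}) with hp
  have hps : ∑ b ∈ s, p b = μ.real (f ⁻¹' s) := sum_measureReal_fiber μ hf s
  have hpc : ∑ b ∈ sᶜ, p b = μ.real (f ⁻¹' s)ᶜ := by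
    rw [sum_measureReal_fiber μ hf]; congr 1; ext; simp
  have hp1 : ∑ b, p b = 1 := sum_measureReal_fiber_univ μ hf
  have hN0 : 0 < N := by linarith
  have hB0 : 0 < B := by linarith
  -- The comparison weights give mass at most `1/2` to `s` and at most `1/2` to its complement,
  -- hence the term `log 2`. Gibbs' inequality needs only total mass at most `1`, so upper bounds
  -- for the two cardinalities suffice.
  set q : β → ℝ := fun b => if b ∈ s then (2 * N)⁻¹ else (2 * B)⁻¹ with hq
  have hq0 : ∀ b, 0 < q b := fun b => by simp only [hq]; split_ifs <;> positivity
  have key := sum_negMulLog_le Finset.univ p q (fun _ _ => measureReal_nonneg)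
    (fun b _ => (hq0 b).le) (fun b _ h => absurd h (hq0 b).ne') (by
      rw [hp1, ← Finset.sum_add_sum_compl s q]
      have h1 : ∑ b ∈ s, q b = s.card * (2 * N)⁻¹ := by
        rw [Finset.sum_congr rfl fun b hb => show q b = (2 * N)⁻¹ by simp [hq, hb]]
        simp
      have h2 : ∑ b ∈ sᶜ, q b = (sᶜ).card * (2 * B)⁻¹ := by
        rw [Finset.sum_congr rfl fun b hb => show q b = (2 * B)⁻¹ by
          simp [hq, Finset.mem_compl.1 hb]]
        simp
      have h3 : ((sᶜ).card : ℝ) ≤ B := by rw [hB]; exact_mod_cast Finset.card_le_univ _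
      have h4 : (s.card : ℝ) * (2 * N)⁻¹ ≤ N * (2 * N)⁻¹ := by gcongr
      have h5 : ((sᶜ).card : ℝ) * (2 * B)⁻¹ ≤ B * (2 * B)⁻¹ := by gcongr
      have h6 : N * (2 * N)⁻¹ = 1 / 2 := by field_simp
      have h7 : B * (2 * B)⁻¹ = 1 / 2 := by field_simp
      linarith)
  refine key.trans ?_
  rw [← Finset.sum_add_sum_compl s]
  have e1 : ∑ b ∈ s, -(p b * Real.log (q b)) = μ.real (f ⁻¹' s) * (Real.log 2 + Real.log N) := by
    rw [← hps, Finset.sum_mul]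
    refine Finset.sum_congr rfl fun b hb => ?_
    simp [hq, hb, Real.log_mul, hN0.ne']
    ring
  have e2 : ∑ b ∈ sᶜ, -(p b * Real.log (q b))
      = μ.real (f ⁻¹' s)ᶜ * (Real.log 2 + Real.log B) := by
    rw [← hpc, Finset.sum_mul]
    refine Finset.sum_congr rfl fun b hb => ?_
    simp [hq, Finset.mem_compl.1 hb, Real.log_mul, hB0.ne']
    ring
  have e3 : μ.real (f ⁻¹' s) + μ.real (f ⁻¹' s)ᶜ = 1 := by
    rw [← hps, ← hpc, Finset.sum_add_sum_compl, hp1]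
  rw [e1, e2]
  have := mul_le_mul_of_nonneg_right (show μ.real (f ⁻¹' s) ≤ 1 from measureReal_le_one)
    (Real.log_nonneg hN1)
  linear_combination this + Real.log 2 * e3

/-- Entropy is the mean of `-log` of the fiber probabilities, each at least `-log B`. -/
theorem le_shannon_of_fiber_le (μ : Measure Ω) [IsProbabilityMeasure μ] {f : Ω → β}
    (hf : Measurable f) {B : ℝ} (hB : ∀ b, μ.real (f ⁻¹' {b}) ≤ B) :
    -Real.log B ≤ shannon μ f := by
  have h1 := sum_measureReal_fiber_univ μ hf
  calc -Real.log B = ∑ b, μ.real (f ⁻¹' {b}) * -Real.log B := by rw [← Finset.sum_mul, h1, one_mul]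
    _ ≤ shannon μ f := by
      refine Finset.sum_le_sum fun b _ => ?_
      rw [Real.negMulLog, neg_mul, mul_neg, neg_le_neg_iff]
      rcases (measureReal_nonneg (μ := μ) (s := f ⁻¹' {b})).eq_or_lt with h | h
      · simp [← h]
      · exact mul_le_mul_of_nonneg_left (Real.log_le_log h (hB b)) h.le

end Shannon

/-! ### Entropy of a shift-invariant measure through its blocks -/

section Blocks

variable {A : Type*}

/-- The word `x[0, n)` as a function on `Fin n`. -/
def block (n : ℕ) (x : ℤ → A) : Fin n → A := fun i => x (i : ℕ)

theorem word_add_natCast (x : ℤ → A) (a : ℤ) (n : ℕ) :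
    word x a (a + n) = List.ofFn fun i : Fin n => x (a + (i : ℕ)) := by
  apply List.ext_getElem
  · simp [word]
  · intro i h1 h2
    simp [word]

@[simp]
theorem length_word (x : ℤ → A) (a b : ℤ) : (word x a b).length = (b - a).toNat := by
  simp [word]

theorem word_congr {x y : ℤ → A} {a b : ℤ} (h : ∀ t, a ≤ t → t < b → x t = y t) :
    word x a b = word y a b := by
  refine congrArg List.ofFn (funext fun i => h _ (by omega) ?_)
  have := i.2
  omega

theorem word_zero_natCast (x : ℤ → A) (n : ℕ) : word x 0 n = List.ofFn (block n x) := by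
  have := word_add_natCast x 0 n
  simp only [zero_add] at this
  exact this

theorem cylinder_ofFn {n : ℕ} (u : Fin n → A) : cylinder (List.ofFn u) = block n ⁻¹' {u} := by
  ext x
  have : (List.ofFn u).length = n := by simp
  simp only [cylinder, Set.mem_ofPred_eq, Set.mem_preimage, Set.mem_singleton_iff]
  rw [this, word_zero_natCast]
  exact List.ofFn_injective.eq_iff

theorem shift_iterate (x : ℤ → A) (n : ℕ) (i : ℤ) : shift^[n] x i = x (i + n) := by
  induction n generalizing x with
  | zero => simp
  | succ n ih => rw [Function.iterate_succ_apply, ih]; simp only [shift]; push_cast; congr 1; ring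

theorem block_add (m n : ℕ) (x : ℤ → A) :
    block (m + n) x = Fin.append (block m x) (block n (shift^[m] x)) := by
  funext i
  refine Fin.addCases (fun i => ?_) (fun i => ?_) i
  · simp [block]
  · simp [block, shift_iterate, add_comm]

variable [MeasurableSpace A]

theorem measurable_shift : Measurable (shift : (ℤ → A) → ℤ → A) :=
  measurable_pi_lambda _ fun i => measurable_pi_apply (i + 1)

theorem measurable_block (n : ℕ) : Measurable (block n : (ℤ → A) → Fin n → A) :=
  measurable_pi_lambda _ fun _ => measurable_pi_apply _

variable [Fintype A]

/-- Words outside the language of `X` have null cylinders, so the sum may run over all words of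
length `n`. -/
theorem entropy_sum_eq (X : Set (ℤ → A)) (μ : Measure (ℤ → A)) (hX : μ Xᶜ = 0) (n : ℕ) :
    -(1 / (n : ℝ)) * ∑ w ∈ (language_finite X n).toFinset,
      μ.real (cylinder w) * Real.log (μ.real (cylinder w)) = shannon μ (block (A := A) n) / n := by
  classical
  have hsub : (language_finite X n).toFinset
      ⊆ Finset.univ.image (List.ofFn : (Fin n → A) → List A) := by
    intro w hw
    obtain ⟨x, -, a, rfl⟩ := (language_finite X n).mem_toFinset.1 hw
    rw [word_add_natCast]
    simp
  rw [Finset.sum_subset hsub, Finset.sum_image List.ofFn_injective.injOn]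
  · simp only [cylinder_ofFn, shannon, Real.negMulLog, neg_mul, Finset.sum_neg_distrib]
    ring
  · intro w hw hwL
    obtain ⟨u, -, rfl⟩ := Finset.mem_image.1 hw
    have : μ.real (cylinder (List.ofFn u)) = 0 := by
      rw [measureReal_def, measure_mono_null ?_ hX]; · simp
      intro x hx hxX
      refine hwL ((language_finite X n).mem_toFinset.2 ⟨x, hxX, 0, ?_⟩)
      rw [cylinder_ofFn] at hx
      have hx' : block n x = u := hx
      rw [zero_add, word_zero_natCast, hx']
    simp [this]

variable [MeasurableSingletonClass A]

theorem shannon_block_subadditive (μ : Measure (ℤ → A)) [IsProbabilityMeasure μ]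
    (hμ : MeasurePreserving shift μ μ) : Subadditive fun n => shannon μ (block (A := A) n) := by
  classical
  intro m n
  have h1 : shannon μ (block (A := A) (m + n))
      = shannon μ (fun x => (block m x, block n (shift^[m] x))) := by
    rw [← shannon_equiv_comp μ _ (Fin.appendEquiv m n)]
    congr 1
    funext x
    exact block_add m n x
  have h2 : shannon μ (fun x => block n (shift^[m] x)) = shannon μ (block (A := A) n) := by
    refine Finset.sum_congr rfl fun b _ => ?_
    congr 1
    exact (hμ.iterate m).measureReal_preimage
      ((measurable_block n) (measurableSet_singleton b)).nullMeasurableSet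
  refine h1.trans_le ?_
  dsimp only
  rw [← h2]
  exact shannon_pair_le μ (measurable_block m)
    ((measurable_block n).comp (hμ.iterate m).measurable)

/-- Fekete's lemma, with lower bound `0`. -/
theorem tendsto_shannon_block (μ : Measure (ℤ → A)) [IsProbabilityMeasure μ]
    (hμ : MeasurePreserving shift μ μ) :
    ∃ h, Tendsto (fun n : ℕ => shannon μ (block (A := A) n) / n) atTop (nhds h) :=
  ⟨_, (shannon_block_subadditive μ hμ).tendsto_lim
    ⟨0, by rintro _ ⟨n, rfl⟩; exact div_nonneg (shannon_nonneg _ _) n.cast_nonneg⟩⟩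

/-- Since the limit exists, the `limUnder` in `entropy` is a genuine limit and not a default value.
-/
theorem tendsto_shannon_block_entropy (X : Set (ℤ → A)) (μ : Measure (ℤ → A))
    [IsProbabilityMeasure μ] (hμ : MeasurePreserving shift μ μ) (hX : μ Xᶜ = 0) :
    Tendsto (fun n : ℕ => shannon μ (block (A := A) n) / n) atTop (nhds (entropy X μ)) := by
  obtain ⟨h, hh⟩ := tendsto_shannon_block μ hμ
  have : entropy X μ = h := by
    rw [entropy]
    simp only [entropy_sum_eq X μ hX]
    exact hh.limUnder_eq
  rwa [this]

end Blocks

/-! ### Increasing sequences of cutting points -/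

section Cuts

theorem StrictMono.add_sub_le {k : ℤ → ℤ} (hk : StrictMono k) {i j : ℤ} (hij : i ≤ j) :
    k i + (j - i) ≤ k j := by
  induction j, hij using Int.leInduction with
  | base => simp
  | succ j hij ih => have := hk (lt_add_one j); omega

theorem StrictMono.exists_mem_Ico {k : ℤ → ℤ} (hk : StrictMono k) (t : ℤ) :
    ∃ i, k i ≤ t ∧ t < k (i + 1) := by
  obtain ⟨i, hi, hmax⟩ := Int.exists_greatest_of_bdd (P := fun i => k i ≤ t)
    ⟨max 0 (t - k 0), fun z hz => by
      by_contra! h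
      have := StrictMono.add_sub_le hk (show (0 : ℤ) ≤ z by omega)
      omega⟩
    ⟨min 0 (t - k 0), by
      have := StrictMono.add_sub_le hk (show min 0 (t - k 0) ≤ (0 : ℤ) by omega)
      omega⟩
  refine ⟨i, hi, ?_⟩
  by_contra! h
  have := hmax _ h
  omega

theorem StrictMono.mem_Ico_unique {k : ℤ → ℤ} (hk : StrictMono k) {t i j : ℤ}
    (hi : k i ≤ t ∧ t < k (i + 1)) (hj : k j ≤ t ∧ t < k (j + 1)) : i = j := by
  have h1 := hk.lt_iff_lt.1 (hi.1.trans_lt hj.2)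
  have h2 := hk.lt_iff_lt.1 (hj.1.trans_lt hi.2)
  omega

/-- Increasing enumerations of one set differ by an index shift, and agreement at one index excludes
a nonzero shift. The proof moves from each index to its neighbours. -/
theorem StrictMono.eq_of_range_eq {k k' : ℤ → ℤ} (hk : StrictMono k) (hk' : StrictMono k')
    (hr : Set.range k = Set.range k') {a : ℤ} (ha : k a = k' a) : k = k' := by
  have key : ∀ (p q : ℤ → ℤ), StrictMono p → StrictMono q → Set.range p = Set.range q → ∀ i,
      p i = q i → q (i + 1) ≤ p (i + 1) ∧ p (i - 1) ≤ q (i - 1) := by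
    intro p q hp hq h i hi
    constructor
    · obtain ⟨j, hj⟩ : p (i + 1) ∈ Set.range q := h ▸ ⟨_, rfl⟩
      have : i < j := hq.lt_iff_lt.1 (by rw [hj, ← hi]; exact hp (lt_add_one i))
      rw [← hj]
      exact hq.monotone (by omega)
    · obtain ⟨j, hj⟩ : p (i - 1) ∈ Set.range q := h ▸ ⟨_, rfl⟩
      have : j < i := hq.lt_iff_lt.1 (by rw [hj, ← hi]; exact hp (sub_one_lt i))
      rw [← hj]
      exact hq.monotone (by omega)
  funext i
  induction i using Int.inductionOn' (b := a) with
  | zero => exact ha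
  | succ i _ ih => exact le_antisymm (key k' k hk' hk hr.symm i ih.symm).1 (key k k' hk hk' hr i ih).1
  | pred i _ ih => exact le_antisymm (key k k' hk hk' hr i ih).2 (key k' k hk' hk hr.symm i ih.symm).2

/-- The cutting points, starting from `0`, with the given gaps. -/
def cut (ℓ : ℤ → ℕ) (i : ℤ) : ℤ :=
  ∑ j ∈ Finset.range i.toNat, (ℓ j : ℤ) - ∑ j ∈ Finset.range (-i).toNat, (ℓ (-1 - j) : ℤ)

@[simp]
theorem cut_zero (ℓ : ℤ → ℕ) : cut ℓ 0 = 0 := by simp [cut]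

theorem cut_natCast (ℓ : ℤ → ℕ) (n : ℕ) : cut ℓ n = ∑ j ∈ Finset.range n, (ℓ j : ℤ) := by
  simp [cut]

theorem cut_add_one (ℓ : ℤ → ℕ) (i : ℤ) : cut ℓ (i + 1) = cut ℓ i + ℓ i := by
  rcases le_or_gt 0 i with h | h
  · lift i to ℕ using h
    rw [← Nat.cast_succ, cut_natCast, cut_natCast, Finset.sum_range_succ]
  · obtain ⟨n, rfl⟩ : ∃ n : ℕ, i = -1 - n := ⟨(-1 - i).toNat, by omega⟩
    have h1 : (-(-1 - (n : ℤ))).toNat = n + 1 := by omega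
    have h2 : (-(-1 - (n : ℤ) + 1)).toNat = n := by omega
    have h3 : (-1 - (n : ℤ)).toNat = 0 := by omega
    have h4 : (-1 - (n : ℤ) + 1).toNat = 0 := by omega
    simp only [cut, h1, h2, h3, h4, Finset.sum_range_succ]
    simp

theorem cut_strictMono {ℓ : ℤ → ℕ} (hℓ : ∀ i, 0 < ℓ i) : StrictMono (cut ℓ) :=
  strictMono_int_of_lt_succ fun i => by rw [cut_add_one]; have := hℓ i; omega

theorem eq_cut_of_add_one {ℓ : ℤ → ℕ} {k : ℤ → ℤ} (h0 : k 0 = 0)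
    (h : ∀ i, k (i + 1) = k i + ℓ i) : k = cut ℓ := by
  funext i
  induction i using Int.inductionOn' (b := 0) with
  | zero => simp [h0]
  | succ i _ ih => rw [h, cut_add_one, ih]
  | pred i _ ih =>
    have h1 := h (i - 1)
    have h2 := cut_add_one ℓ (i - 1)
    rw [sub_add_cancel] at h1 h2
    omega

theorem cut_comp_add_one (ℓ : ℤ → ℕ) (i : ℤ) :
    cut (fun j => ℓ (j + 1)) i = cut ℓ (i + 1) - ℓ 0 := by
  have : (fun i => cut ℓ (i + 1) - ℓ 0) = cut (fun j => ℓ (j + 1)) :=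
    eq_cut_of_add_one (by have := cut_add_one ℓ 0; simp at this ⊢; omega) fun i => by rw [cut_add_one]; omega
  exact (congrFun this i).symm

end Cuts

/-! ### Representations and the rigidity of cuts -/

section Representations

variable {A : Type*} {G : Set (List A)} {x y : ℤ → A} {k k' : ℤ → ℤ}

/-- The sequence moved by `t` places to the left. -/
def translate (t : ℤ) (x : ℤ → A) : ℤ → A := fun i => x (i + t)

theorem word_translate (t : ℤ) (x : ℤ → A) (a b : ℤ) :
    word (translate t x) a b = word x (a + t) (b + t) := by
  apply List.ext_getElem
  · simp
  · intro i h1 h2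
    simp [word, translate, add_right_comm]

theorem IsRepresentation.translate (h : IsRepresentation G x k) (t : ℤ) :
    IsRepresentation G (translate t x) fun i => k i - t :=
  ⟨fun _ _ hij => sub_lt_sub_right (h.1 hij) t, fun i => by
    rw [word_translate, sub_add_cancel, sub_add_cancel]; exact h.2 i⟩

theorem IsRepresentation.comp_add (h : IsRepresentation G x k) (j : ℤ) :
    IsRepresentation G x fun i => k (i + j) :=
  ⟨fun _ _ hab => h.1 (add_lt_add_left hab j), fun i => by
    have := h.2 (i + j)
    rwa [add_right_comm] at this⟩

/-- If two sequences have cuts at the beginning and at the end of a common word, then the cuts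
inside of this word agree. -/
theorem UniquelyRepresents.cuts_eq (hG : UniquelyRepresents G)
    (hx : IsRepresentation G x k) (hy : IsRepresentation G y k') (hk : k 0 = 0) (hk' : k' 0 = 0)
    {m m' : ℕ} {l : ℤ} (hm : k m = l) (hm' : k' m' = l) (hxy : ∀ t, 0 ≤ t → t < l → x t = y t) :
    m = m' ∧ ∀ i : ℕ, i ≤ m → k i = k' i := by
  -- Splice the cuts of `x` inside `[0, l]` into the cuts of `y`. As `x` and `y` agree there, this
  -- is another representation of `y`, with the same cut of index `0`.
  set κ : ℤ → ℤ := fun i => if i ≤ 0 then k' i else if i ≤ m then k i else k' (i - m + m') with hκ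
  have κ1 : ∀ i ≤ 0, κ i = k' i := fun i hi => by simp [hκ, hi]
  have κ2 : ∀ i : ℤ, 0 ≤ i → i ≤ m → κ i = k i := fun i hi hi' => by
    rcases hi.eq_or_lt with rfl | h
    · simp [hκ, hk, hk']
    · simp [hκ, h.not_ge, hi']
  have κ3 : ∀ i, (m : ℤ) ≤ i → κ i = k' (i - m + m') := fun i hi => by
    rcases hi.eq_or_lt with rfl | h
    · rw [κ2 _ (by omega) le_rfl]; simp [hm, hm']
    · have h1 : ¬ i ≤ 0 := by omega
      have h2 : ¬ i ≤ m := by omega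
      simp [hκ, h1, h2]
  have hrep : IsRepresentation G y κ := by
    refine ⟨strictMono_int_of_lt_succ fun i => ?_, fun i => ?_⟩
    · rcases lt_or_ge i 0 with h | h
      · rw [κ1 _ h.le, κ1 _ (by omega)]; exact hy.1 (by omega)
      rcases lt_or_ge i m with h' | h'
      · rw [κ2 _ h h'.le, κ2 _ (by omega) (by omega)]; exact hx.1 (by omega)
      · rw [κ3 _ h', κ3 _ (by omega)]; exact hy.1 (by omega)
    · rcases lt_or_ge i 0 with h | h
      · rw [κ1 _ h.le, κ1 _ (by omega)]; exact hy.2 i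
      rcases lt_or_ge i m with h' | h'
      · rw [κ2 _ h h'.le, κ2 _ (by omega) (by omega), ← word_congr fun t h1 h2 => hxy t ?_ ?_]
        · exact hx.2 i
        · rw [← hk]; exact (hx.1.monotone h).trans h1
        · rw [← hm]; exact h2.trans_le (hx.1.monotone (by omega))
      · rw [κ3 _ h', κ3 _ (by omega), show i + 1 - (m : ℤ) + m' = i - m + m' + 1 by ring]
        exact hy.2 _
  have heq : κ = k' := StrictMono.eq_of_range_eq hrep.1 hy.1
    (hG y ⟨_, hy⟩ _ _ hrep hy) (κ1 0 le_rfl)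
  constructor
  · have : k' m = k' m' := by rw [← heq, κ2 _ (by omega) le_rfl, hm, heq, hm']
    exact_mod_cast hy.1.injective this
  · intro i hi
    rw [← heq, κ2 _ (by omega) (by omega)]

end Representations

theorem measurable_translate {A : Type*} [MeasurableSpace A] (t : ℤ) : Measurable (translate t : (ℤ → A) → ℤ → A) :=
  measurable_pi_lambda _ fun i => measurable_pi_apply (i + t)

/-! ### Coding sequences of code words by their concatenations -/

section Coding

variable {A ι : Type*} (c : ι → List A)

/-- The gaps between the cutting points of a sequence of code words. -/
def lengths (ω : ℤ → ι) : ℤ → ℕ := fun i => (c (ω i)).length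

variable {c}

theorem lengths_pos (hc : ∀ g, c g ≠ []) (ω : ℤ → ι) (i : ℤ) : 0 < lengths c ω i := List.length_pos_iff.2 (hc _)

theorem exists_coding (hc : ∀ g, c g ≠ []) (ω : ℤ → ι) : ∃ x : ℤ → A, ∀ (i : ℤ) (s : ℕ), s < lengths c ω i →
    (c (ω i))[s]? = some (x (cut (lengths c ω) i + s)) := by
  have hmono := cut_strictMono (lengths_pos hc ω)
  have : ∀ t : ℤ, ∃ a : A, ∃ i, cut (lengths c ω) i ≤ t ∧ t < cut (lengths c ω) (i + 1) ∧
      (c (ω i))[(t - cut (lengths c ω) i).toNat]? = some a := by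
    intro t
    obtain ⟨i, h1, h2⟩ := StrictMono.exists_mem_Ico hmono t
    have h3 := h2
    rw [cut_add_one, lengths] at h3
    have : (t - cut (lengths c ω) i).toNat < (c (ω i)).length := by omega
    exact ⟨_, i, h1, h2, List.getElem?_eq_getElem this⟩
  choose x i h1 h2 h3 using this
  refine ⟨x, fun j s hs => ?_⟩
  -- Each place lies in only one gap, so the gap chosen for it must be the `j`-th.
  have := StrictMono.mem_Ico_unique hmono ⟨h1 (cut (lengths c ω) j + s), h2 _⟩
    (j := j) ⟨by omega, by rw [cut_add_one]; omega⟩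
  have h4 := h3 (cut (lengths c ω) j + s)
  rw [this] at h4
  rw [← h4]
  congr
  omega

variable (hc : ∀ g, c g ≠ [])

/-- The concatenation `⋯ c(ω₋₁) c(ω₀) c(ω₁) ⋯`, with `c(ω₀)` beginning at `0`. -/
noncomputable def coding (ω : ℤ → ι) : ℤ → A := (exists_coding hc ω).choose

theorem coding_spec (ω : ℤ → ι) (i : ℤ) (s : ℕ) (hs : s < lengths c ω i) :
    (c (ω i))[s]? = some (coding hc ω (cut (lengths c ω) i + s)) :=
  (exists_coding hc ω).choose_spec i s hs

theorem word_coding (ω : ℤ → ι) (i : ℤ) :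
    word (coding hc ω) (cut (lengths c ω) i) (cut (lengths c ω) (i + 1)) = c (ω i) := by
  rw [cut_add_one, word_add_natCast]
  apply List.ext_getElem
  · simp [lengths]
  · intro s h1 h2
    have := coding_spec hc ω i s h2
    rw [List.getElem?_eq_getElem h2, Option.some_inj] at this
    simp [this]

theorem isRepresentation_coding (ω : ℤ → ι) :
    IsRepresentation (Set.range c) (coding hc ω) (cut (lengths c ω)) :=
  ⟨cut_strictMono (lengths_pos hc ω), fun i => ⟨ω i, (word_coding hc ω i).symm⟩⟩

theorem coding_mem_seqSet (ω : ℤ → ι) : coding hc ω ∈ seqSet (Set.range c) :=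
  ⟨_, isRepresentation_coding hc ω⟩

theorem eq_coding (ω : ℤ → ι) {x : ℤ → A}
    (h : ∀ i, word x (cut (lengths c ω) i) (cut (lengths c ω) (i + 1)) = c (ω i)) :
    x = coding hc ω := by
  funext t
  obtain ⟨i, h1, h2⟩ := StrictMono.exists_mem_Ico (cut_strictMono (lengths_pos hc ω)) t
  have h3 := (h i).trans (word_coding hc ω i).symm
  rw [cut_add_one, word_add_natCast, word_add_natCast, List.ofFn_inj] at h3
  rw [cut_add_one] at h2
  have h4 := congrFun h3 ⟨(t - cut (lengths c ω) i).toNat, by omega⟩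
  have h5 : ((t - cut (lengths c ω) i).toNat : ℤ) = t - cut (lengths c ω) i := by omega
  simpa [h5] using h4

/-- The image of `coding` is the set of sequences with a cut at `0`. Its translates therefore record
where a sequence has cuts. -/
theorem mem_range_coding {x : ℤ → A} :
    x ∈ Set.range (coding hc) ↔ ∃ k, IsRepresentation (Set.range c) x k ∧ k 0 = 0 := by
  constructor
  · rintro ⟨ω, rfl⟩
    exact ⟨_, isRepresentation_coding hc ω, cut_zero _⟩
  · rintro ⟨k, hk, h0⟩
    choose ω hω using hk.2
    have : k = cut (lengths c ω) := eq_cut_of_add_one h0 fun i => by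
      rw [lengths, hω, length_word]
      have := hk.1 (lt_add_one i)
      omega
    subst this
    exact ⟨ω, (eq_coding hc ω fun i => (hω i).symm).symm⟩

theorem mem_range_coding_of_cut {x : ℤ → A} {k : ℤ → ℤ}
    (hk : IsRepresentation (Set.range c) x k) (i : ℤ) :
    translate (k i) x ∈ Set.range (coding hc) :=
  (mem_range_coding hc).2 ⟨_, (hk.translate (k i)).comp_add i, by simp⟩

theorem exists_cut_of_mem_range_coding {x : ℤ → A} {t : ℤ}
    (hx : translate t x ∈ Set.range (coding hc)) :
    ∃ k, IsRepresentation (Set.range c) x k ∧ k 0 = t := by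
  obtain ⟨k, hk, h0⟩ := (mem_range_coding hc).1 hx
  refine ⟨fun i => k i - -t, ?_, show k 0 - -t = t by omega⟩
  have := hk.translate (-t)
  have e : translate (-t) (translate t x) = x := by funext i; simp [translate]
  rwa [e] at this

theorem seqSet_eq_iUnion :
    seqSet (Set.range c) = ⋃ t : ℤ, translate t ⁻¹' Set.range (coding hc) := by
  ext x
  rw [Set.mem_iUnion]
  constructor
  · rintro ⟨k, hk⟩
    exact ⟨k 0, mem_range_coding_of_cut hc hk 0⟩
  · rintro ⟨t, ht⟩
    obtain ⟨k, hk, -⟩ := exists_cut_of_mem_range_coding hc ht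
    exact ⟨k, hk⟩

/-- Moving the origin to the next cut corresponds to shifting the sequence of code words. -/
theorem translate_coding (ω : ℤ → ι) :
    translate (lengths c ω 0) (coding hc ω) = coding hc fun i => ω (i + 1) := by
  apply eq_coding
  intro i
  rw [word_translate]
  have h : lengths c (fun i => ω (i + 1)) = fun j => lengths c ω (j + 1) := rfl
  rw [h, cut_comp_add_one, cut_comp_add_one, sub_add_cancel, sub_add_cancel]
  exact word_coding hc ω (i + 1)

theorem coding_injective (hinj : Function.Injective c) (hG : UniquelyRepresents (Set.range c)) :
    Function.Injective (coding hc) := by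
  intro ω ω' h
  have h1 := isRepresentation_coding hc ω
  have h2 := isRepresentation_coding hc ω'
  rw [h] at h1
  have h3 : cut (lengths c ω) = cut (lengths c ω') := StrictMono.eq_of_range_eq h1.1 h2.1
    (hG _ (coding_mem_seqSet hc ω') _ _ h1 h2) (a := 0) (by simp)
  funext i
  apply hinj
  rw [← word_coding hc ω, ← word_coding hc ω', h, h3]

variable [MeasurableSpace ι] [DiscreteMeasurableSpace ι]

theorem measurable_cut (i : ℤ) : Measurable fun ω : ℤ → ι => cut (lengths c ω) i := by
  unfold cut lengths
  have : ∀ j : ℤ, Measurable fun ω : ℤ → ι => ((c (ω j)).length : ℤ) := fun j =>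
    (Measurable.of_discrete (f := fun g => ((c g).length : ℤ))).comp (measurable_pi_apply j)
  exact (Finset.measurable_fun_sum _ fun _ _ => this _).sub
    (Finset.measurable_fun_sum _ fun _ _ => this _)

variable [MeasurableSpace A] [Countable A] [Countable ι]

theorem measurable_coding : Measurable (coding hc) := by
  refine measurable_pi_lambda _ fun t => measurable_to_countable' fun a => ?_
  -- The letter at `t` depends only on the code word covering `t` and on the cut where it starts.
  -- The index of that word varies with `ω`, hence the countable union.
  have : (fun ω => coding hc ω t) ⁻¹' {a} = ⋃ i : ℤ, (fun ω : ℤ → ι =>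
      (cut (lengths c ω) i, ω i)) ⁻¹' {p | p.1 ≤ t ∧ (c p.2)[(t - p.1).toNat]? = some a} := by
    ext ω
    simp only [Set.mem_preimage, Set.mem_singleton_iff, Set.mem_iUnion, Set.mem_ofPred_eq]
    have key : ∀ i, cut (lengths c ω) i ≤ t → t < cut (lengths c ω) (i + 1) →
        (c (ω i))[(t - cut (lengths c ω) i).toNat]? = some (coding hc ω t) := by
      intro i h1 h2
      rw [cut_add_one] at h2
      rw [coding_spec hc ω i _ (by omega), Int.toNat_of_nonneg (by omega)]
      congr 2; omega
    constructor
    · rintro rfl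
      obtain ⟨i, h1, h2⟩ := StrictMono.exists_mem_Ico (cut_strictMono (lengths_pos hc ω)) t
      exact ⟨i, h1, key i h1 h2⟩
    · rintro ⟨i, h1, h2⟩
      obtain ⟨h3, -⟩ := List.getElem?_eq_some_iff.1 h2
      have h4 : (t - cut (lengths c ω) i).toNat < lengths c ω i := h3
      have := key i h1 (by rw [cut_add_one]; omega)
      rw [this] at h2
      exact Option.some_inj.1 h2
  rw [this]
  exact MeasurableSet.iUnion fun i =>
    ((measurable_cut i).prodMk (measurable_pi_apply i)) (MeasurableSet.of_discrete)

/-- Lusin–Souslin: an injective measurable image of a standard Borel space is measurable.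
Injectivity is where unique representation enters. -/
theorem measurableSet_range_coding [MeasurableSingletonClass A] (hinj : Function.Injective c)
    (hG : UniquelyRepresents (Set.range c)) : MeasurableSet (Set.range (coding hc)) :=
  ((measurable_coding hc).measurableEmbedding (coding_injective hc hinj hG)).measurableSet_range

theorem measurableSet_seqSet (hc : ∀ g, c g ≠ []) [MeasurableSingletonClass A] (hinj : Function.Injective c)
    (hG : UniquelyRepresents (Set.range c)) : MeasurableSet (seqSet (Set.range c)) := by
  rw [seqSet_eq_iUnion hc]
  exact MeasurableSet.iUnion fun t =>
    measurable_translate t (measurableSet_range_coding hc hinj hG)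

end Coding

/-! ### Counting concatenations -/

section Counting

variable {A ι : Type*}

/-- The words of length `m` that are concatenations of code words. -/
def concatWords (c : ι → List A) (m : ℕ) : Set (List A) :=
  {w | w.length = m ∧ ∃ gs : List ι, (gs.map c).flatten = w}

theorem word_append (x : ℤ → A) {a b d : ℤ} (hab : a ≤ b) (hbd : b ≤ d) :
    word x a b ++ word x b d = word x a d := by
  apply List.ext_getElem
  · simp; omega
  · intro i h1 h2
    simp only [List.getElem_append, word, List.length_ofFn, List.getElem_ofFn]
    split_ifs with h
    · rfl
    · congr 1; omega

theorem IsRepresentation.word_mem_concatWords {c : ι → List A} {x : ℤ → A} {k : ℤ → ℤ}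
    (hk : IsRepresentation (Set.range c) x k) {i j : ℤ} (hij : i ≤ j) :
    word x (k i) (k j) ∈ concatWords c (k j - k i).toNat := by
  refine ⟨length_word _ _ _, ?_⟩
  induction j, hij using Int.leInduction with
  | base => exact ⟨[], by simp [word]⟩
  | succ j hij ih =>
    obtain ⟨gs, hgs⟩ := ih
    obtain ⟨g, hg⟩ := hk.2 j
    refine ⟨gs ++ [g], ?_⟩
    rw [← word_append x (hk.1.monotone hij) (hk.1 (lt_add_one j)).le, ← hg, ← hgs]
    simp

variable [Fintype A]

theorem concatWords_finite (c : ι → List A) (m : ℕ) : (concatWords c m).Finite :=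
  (List.finite_length_eq A m).subset fun _ h => h.1

theorem ncard_length_eq (n : ℕ) : {w : List A | w.length = n}.ncard = Fintype.card A ^ n := by
  have : {w : List A | w.length = n} = Set.range (List.ofFn : (Fin n → A) → List A) := by
    ext w
    constructor
    · rintro rfl
      exact ⟨w.get, List.ofFn_get w⟩
    · rintro ⟨u, rfl⟩
      simp
  rw [this, Set.ncard_range_of_injective List.ofFn_injective]
  simp

/-- The number of concatenations of length `m` grows at most like `λ ^ m`. -/
theorem ncard_concatWords_le {c : ι → List A} (hinj : Function.Injective c) (hc : ∀ g, c g ≠ [])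
    {lam : ℝ} (hlam : 0 < lam) (hsum : HasSum (fun g => lam⁻¹ ^ (c g).length) 1) (m : ℕ) :
    ((concatWords c m).ncard : ℝ) ≤ lam ^ m := by
  classical
  induction m using Nat.strong_induction_on with
  | _ m ih =>
    rcases m.eq_zero_or_pos with rfl | hm
    · have : concatWords c 0 ⊆ {[]} := fun w hw => List.length_eq_zero_iff.1 hw.1
      have h := Set.ncard_le_ncard this
      rw [Set.ncard_singleton] at h
      simpa using h
    · have hfin : {g | (c g).length ≤ m}.Finite :=
        Set.Finite.preimage hinj.injOn (List.finite_length_le A m)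
      set S := hfin.toFinset with hS
      -- A nonempty concatenation splits into its first code word and a shorter concatenation.
      have hsub : concatWords c m ⊆ ⋃ g ∈ S, (c g ++ ·) '' concatWords c (m - (c g).length) := by
        rintro w ⟨hw, gs, rfl⟩
        cases gs with
        | nil => simp at hw; omega
        | cons g gs =>
          simp only [List.map_cons, List.flatten_cons, List.length_append] at hw
          simp only [Set.mem_iUnion]
          refine ⟨g, hfin.mem_toFinset.2 (show (c g).length ≤ m by omega), _, ⟨?_, gs, rfl⟩, by simp⟩
          omega
      have h1 : (concatWords c m).ncard
          ≤ ∑ g ∈ S, (concatWords c (m - (c g).length)).ncard := by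
        refine (Set.ncard_le_ncard hsub ?_).trans ((Finset.set_ncard_biUnion_le S _).trans
          (Finset.sum_le_sum fun g _ => Set.ncard_image_le (concatWords_finite c _)))
        exact S.finite_toSet.biUnion fun g _ => (concatWords_finite c _).image _
      calc ((concatWords c m).ncard : ℝ)
          ≤ ∑ g ∈ S, ((concatWords c (m - (c g).length)).ncard : ℝ) := by exact_mod_cast h1
        _ ≤ ∑ g ∈ S, lam ^ m * lam⁻¹ ^ (c g).length := by
          refine Finset.sum_le_sum fun g hg => ?_
          have hg : (c g).length ≤ m := hfin.mem_toFinset.1 hg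
          have hg0 := List.length_pos_iff.2 (hc g)
          refine (ih _ (by omega)).trans_eq ?_
          rw [inv_pow, ← div_eq_mul_inv, pow_sub₀ _ hlam.ne' hg, div_eq_mul_inv]
        _ ≤ lam ^ m := by
          rw [← Finset.mul_sum]
          exact mul_le_of_le_one_right (by positivity)
            (sum_le_hasSum S (fun g _ => by positivity) hsum)

/-- The words of length `n` that are concatenations of code words up to a beginning and an end
shorter than `L`. -/
def almostConcatWords (c : ι → List A) (L n : ℕ) : Set (List A) :=
  {w | w.length = n ∧ ∃ s u p, s ++ (u ++ p) = w ∧ s.length < L ∧ p.length < L ∧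
    u ∈ concatWords c u.length}

/-- There are `L * L` choices for the lengths of the two ends and at most `|A| ^ L` words for each
end. The middle is counted by `ncard_concatWords_le`, and `1 ≤ λ` allows raising its exponent to
`n`. -/
theorem ncard_almostConcatWords_le [Nonempty A] {c : ι → List A} (hinj : Function.Injective c)
    (hc : ∀ g, c g ≠ []) {lam : ℝ} (hlam : 1 ≤ lam)
    (hsum : HasSum (fun g => lam⁻¹ ^ (c g).length) 1) (L n : ℕ) :
    ((almostConcatWords c L n).ncard : ℝ)
      ≤ (L * L * ((Fintype.card A : ℝ) ^ L * (Fintype.card A : ℝ) ^ L)) * lam ^ n := by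
  classical
  have hA : (1 : ℝ) ≤ Fintype.card A := by exact_mod_cast Fintype.card_pos
  set W : ℕ × ℕ → Set (List A × List A × List A) := fun ij =>
    {w : List A | w.length = ij.1} ×ˢ (concatWords c (n - ij.1 - ij.2) ×ˢ
      {w : List A | w.length = ij.2}) with hW
  have hWfin : ∀ ij, (W ij).Finite := fun ij => (List.finite_length_eq A _).prod
    ((concatWords_finite c _).prod (List.finite_length_eq A _))
  set f : List A × List A × List A → List A := fun t => t.1 ++ (t.2.1 ++ t.2.2)
  have hsub : almostConcatWords c L n ⊆ ⋃ ij ∈ Finset.range L ×ˢ Finset.range L, f '' W ij := by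
    rintro w ⟨hw, s, u, p, rfl, hs, hp, hu⟩
    simp only [Set.mem_iUnion]
    refine ⟨(s.length, p.length), by simp [hs, hp], (s, u, p), ⟨rfl, ?_, rfl⟩, rfl⟩
    simp only [List.length_append] at hw
    rwa [show n - s.length - p.length = u.length by omega]
  have h1 : (almostConcatWords c L n).ncard
      ≤ ∑ ij ∈ Finset.range L ×ˢ Finset.range L, (W ij).ncard := by
    refine (Set.ncard_le_ncard hsub ?_).trans ((Finset.set_ncard_biUnion_le _ _).trans
      (Finset.sum_le_sum fun g _ => Set.ncard_image_le (hWfin _)))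
    exact (Finset.finite_toSet _).biUnion fun g _ => (hWfin g).image _
  calc ((almostConcatWords c L n).ncard : ℝ)
      ≤ ∑ ij ∈ Finset.range L ×ˢ Finset.range L, ((W ij).ncard : ℝ) := by exact_mod_cast h1
    _ ≤ ∑ ij ∈ Finset.range L ×ˢ Finset.range L,
        ((Fintype.card A : ℝ) ^ L * (Fintype.card A : ℝ) ^ L) * lam ^ n := by
      refine Finset.sum_le_sum fun ij hij => ?_
      simp only [Finset.mem_product, Finset.mem_range] at hij
      rw [hW]
      simp only [Set.ncard_prod, ncard_length_eq]
      push_cast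
      have e1 : (Fintype.card A : ℝ) ^ ij.1 ≤ (Fintype.card A : ℝ) ^ L :=
        pow_le_pow_right₀ hA hij.1.le
      have e2 : (Fintype.card A : ℝ) ^ ij.2 ≤ (Fintype.card A : ℝ) ^ L :=
        pow_le_pow_right₀ hA hij.2.le
      have e3 : ((concatWords c (n - ij.1 - ij.2)).ncard : ℝ) ≤ lam ^ n :=
        (ncard_concatWords_le hinj hc (by linarith) hsum _).trans
          (pow_le_pow_right₀ hlam (by omega))
      calc _ ≤ (Fintype.card A : ℝ) ^ L * (lam ^ n * (Fintype.card A : ℝ) ^ L) := by gcongr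
        _ = _ := by ring
    _ = _ := by simp [mul_assoc]

end Counting

/-! ### Cuts near the ends of a block -/

section UpperBound

variable {A ι : Type*} {c : ι → List A} (hc : ∀ g, c g ≠ [])

/-- The sequences with a cut at some place in `I`. -/
def cutIn (I : Set ℤ) : Set (ℤ → A) := ⋃ t ∈ I, translate t ⁻¹' Set.range (coding hc)

/-- By unique representation, the cuts seen near the two ends belong to one representation, so a
concatenation lies between them. The bound `2 * L ≤ n` puts the two cuts in the right order. -/
theorem word_mem_almostConcatWords (hG : UniquelyRepresents (Set.range c)) {L n : ℕ}
    (hn : 2 * L ≤ n) {x : ℤ → A} (h1 : x ∈ cutIn hc (Set.Ico 0 L))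
    (h2 : shift^[n] x ∈ cutIn hc (Set.Ioc (-L) 0)) : word x 0 n ∈ almostConcatWords c L n := by
  simp only [cutIn, Set.mem_iUnion] at h1 h2
  obtain ⟨t, ⟨ht0, htL⟩, h1⟩ := h1
  obtain ⟨s, ⟨hsL, hs0⟩, h2⟩ := h2
  have e : translate s (shift^[n] x) = translate (n + s) x := by
    funext i
    simp only [translate, shift_iterate]
    congr 1; ring
  rw [Set.mem_preimage, e] at h2
  obtain ⟨k, hk, hkt⟩ := exists_cut_of_mem_range_coding hc h1
  obtain ⟨k', hk', hks⟩ := exists_cut_of_mem_range_coding hc h2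
  obtain ⟨j, hj⟩ : (n + s : ℤ) ∈ Set.range k := by
    rw [hG x ⟨k, hk⟩ k k' hk hk']
    exact ⟨0, hks⟩
  have h0j : 0 ≤ j := hk.1.le_iff_le.1 (by omega)
  refine ⟨by simp, word x 0 t, word x t (n + s), word x (n + s) n, ?_, ?_, ?_, ?_⟩
  · rw [word_append x (by omega) (by omega), word_append x (by omega) (by omega)]
  · rw [length_word]; omega
  · rw [length_word]; omega
  · have := hk.word_mem_concatWords h0j
    rwa [hkt, hj, ← length_word x] at this

theorem cutIn_subset_seqSet (I : Set ℤ) : cutIn hc I ⊆ seqSet (Set.range c) := by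
  rw [seqSet_eq_iUnion hc]
  exact Set.iUnion_mono fun t => Set.iUnion_subset fun _ => subset_rfl

theorem cutIn_mono {I J : Set ℤ} (h : I ⊆ J) : cutIn hc I ⊆ cutIn hc J :=
  Set.biUnion_subset_biUnion_left h

variable [MeasurableSpace ι] [DiscreteMeasurableSpace ι] [Countable ι] [MeasurableSpace A]
  [Countable A] [MeasurableSingletonClass A]

theorem measurableSet_cutIn (hinj : Function.Injective c)
    (hG : UniquelyRepresents (Set.range c)) (I : Set ℤ) : MeasurableSet (cutIn hc I) :=
  MeasurableSet.biUnion I.to_countable fun t _ =>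
    measurable_translate t (measurableSet_range_coding hc hinj hG)

/-- Continuity from below: by `hcover` the growing windows eventually meet the cuts of every point
of the sequential set, which has full measure. -/
theorem exists_measureReal_compl_cutIn_le (hinj : Function.Injective c)
    (hG : UniquelyRepresents (Set.range c)) {μ : Measure (ℤ → A)} [IsProbabilityMeasure μ]
    (hμ : μ (seqSet (Set.range c)) = 1) {I : ℕ → Set ℤ} (hI : Monotone I)
    (hcover : ∀ k : ℤ → ℤ, StrictMono k → ∃ i n, k i ∈ I n) {ε : ℝ} (hε : 0 < ε) :
    ∀ᶠ n in atTop, μ.real (cutIn hc (I n))ᶜ ≤ ε := by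
  have hU : ⋃ n, cutIn hc (I n) = seqSet (Set.range c) := by
    refine (Set.iUnion_subset fun n => cutIn_subset_seqSet hc _).antisymm ?_
    rintro x ⟨k, hk⟩
    obtain ⟨i, n, hin⟩ := hcover k hk.1
    exact Set.mem_iUnion.2 ⟨n, Set.mem_biUnion hin (mem_range_coding_of_cut hc hk i)⟩
  have h1 := tendsto_measure_iUnion_atTop (μ := μ) (s := fun n => cutIn hc (I n))
    fun m n hmn => cutIn_mono hc (hI hmn)
  rw [hU, hμ] at h1
  have h2 : Tendsto (fun n => 1 - μ.real (cutIn hc (I n))) atTop (nhds (1 - 1)) :=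
    tendsto_const_nhds.sub ((ENNReal.tendsto_toReal ENNReal.one_ne_top).comp h1)
  rw [sub_self] at h2
  filter_upwards [h2.eventually (gt_mem_nhds hε)] with n hn
  rw [probReal_compl_eq_one_sub (measurableSet_cutIn hc hinj hG _)]
  exact hn.le

end UpperBound

/-! ### The upper bound for the entropy -/

section Entropy

variable {A ι : Type*} {c : ι → List A} [MeasurableSpace ι] [DiscreteMeasurableSpace ι]
  [Countable ι] [MeasurableSpace A] [Fintype A] [MeasurableSingletonClass A]

theorem entropy_le_log (hc : ∀ g, c g ≠ []) (hinj : Function.Injective c)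
    (hG : UniquelyRepresents (Set.range c)) {lam : ℝ} (hlam : 1 ≤ lam)
    (hsum : HasSum (fun g => lam⁻¹ ^ (c g).length) 1) {μ : Measure (ℤ → A)}
    [IsProbabilityMeasure μ] (hinv : MeasurePreserving shift μ μ)
    (hμ : μ (seqSet (Set.range c)) = 1) {h : ℝ}
    (hh : Tendsto (fun n : ℕ => shannon μ (block (A := A) n) / n) atTop (nhds h)) :
    h ≤ Real.log lam := by
  classical
  have : Nonempty A := by
    by_contra hA
    rw [not_nonempty_iff] at hA
    have : seqSet (Set.range c) = ∅ := Set.eq_empty_of_forall_notMem fun x => isEmptyElim (x 0)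
    simp [this] at hμ
  set a : ℝ := Real.log (Fintype.card A) with ha
  have hA : (1 : ℝ) ≤ Fintype.card A := by exact_mod_cast Fintype.card_pos
  have ha0 : 0 ≤ a := Real.log_nonneg hA
  have key : ∀ ε > 0, h ≤ Real.log lam + 2 * ε * a := by
    intro ε hε
    have E1 := exists_measureReal_compl_cutIn_le hc hinj hG hμ (I := fun L => Set.Ico 0 L)
      (fun m n hmn => Set.Ico_subset_Ico_right (by exact_mod_cast hmn)) (fun k hk => by
        obtain ⟨i, -, hi⟩ := StrictMono.exists_mem_Ico hk 0
        exact ⟨i + 1, (k (i + 1)).toNat + 1, hi.le, by omega⟩) hε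
    have E2 := exists_measureReal_compl_cutIn_le hc hinj hG hμ (I := fun L => Set.Ioc (-L) 0)
      (fun m n hmn => Set.Ioc_subset_Ioc_left (by have : (m : ℤ) ≤ n := by exact_mod_cast hmn
                                                  omega)) (fun k hk => by
        obtain ⟨i, hi, -⟩ := StrictMono.exists_mem_Ico hk 0
        exact ⟨i, (-k i).toNat + 1, by push_cast; omega, hi⟩) hε
    -- `L` depends on `ε` but not on `n`, so `log K / n` disappears in the limit.
    obtain ⟨L, ⟨hL1, hL2⟩, hL⟩ := ((E1.and E2).and (eventually_ge_atTop 1)).exists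
    set K : ℝ := L * L * ((Fintype.card A : ℝ) ^ L * (Fintype.card A : ℝ) ^ L) with hK
    have hL' : (1 : ℝ) ≤ L := by exact_mod_cast hL
    have hK1 : 1 ≤ K := one_le_mul_of_one_le_of_one_le
      (one_le_mul_of_one_le_of_one_le hL' hL')
      (one_le_mul_of_one_le_of_one_le (one_le_pow₀ hA) (one_le_pow₀ hA))
    have hbound : ∀ᶠ n : ℕ in atTop, shannon μ (block (A := A) n) / n
        ≤ (Real.log 2 + Real.log K) / n + (Real.log lam + 2 * ε * a) := by
      filter_upwards [eventually_ge_atTop (2 * L), eventually_gt_atTop 0] with n hn hn0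
      set S : Finset (Fin n → A) :=
        Finset.univ.filter fun u => List.ofFn u ∈ almostConcatWords c L n with hS
      have hfin : (almostConcatWords c L n).Finite :=
        (List.finite_length_eq A n).subset fun _ h => h.1
      have hScard : (S.card : ℝ) ≤ K * lam ^ n := by
        refine le_trans ?_ (ncard_almostConcatWords_le hinj hc hlam hsum L n)
        rw [← Finset.card_image_of_injective S List.ofFn_injective, ← Set.ncard_coe_finset]
        refine Nat.cast_le.2 (Set.ncard_le_ncard (fun w hw => ?_) hfin)
        obtain ⟨u, hu, rfl⟩ := Finset.mem_image.1 (Finset.mem_coe.1 hw)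
        exact (Finset.mem_filter.1 hu).2
      -- A bad block lacks a cut near its beginning or near its end. By invariance, the second event
      -- is also measured at the origin.
      have hbad : μ.real (block n ⁻¹' (S : Set (Fin n → A)))ᶜ ≤ 2 * ε := by
        have hsub : (block n ⁻¹' (S : Set (Fin n → A)))ᶜ ⊆ (cutIn hc (Set.Ico 0 L))ᶜ ∪
            shift^[n] ⁻¹' (cutIn hc (Set.Ioc (-L) 0))ᶜ := by
          rw [Set.preimage_compl, ← Set.compl_inter, Set.compl_subset_compl]
          rintro x ⟨h1, h2⟩
          have := word_mem_almostConcatWords hc hG hn h1 h2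
          rw [word_zero_natCast] at this
          simpa [hS] using this
        refine (measureReal_mono hsub).trans ((measureReal_union_le _ _).trans ?_)
        rw [(hinv.iterate n).measureReal_preimage
          (measurableSet_cutIn hc hinj hG _).compl.nullMeasurableSet]
        linarith
      have hmain := shannon_le_of_mostly_mem μ (measurable_block n) S
        (one_le_mul_of_one_le_of_one_le hK1 (one_le_pow₀ hlam)) hScard
      have hn' : (0 : ℝ) < n := by exact_mod_cast hn0
      rw [Real.log_mul (by positivity) (by positivity), Real.log_pow, Fintype.card_fun,
        Fintype.card_fin, Nat.cast_pow, Real.log_pow, ← ha] at hmain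
      have := mul_le_mul_of_nonneg_right hbad (mul_nonneg hn'.le ha0)
      rw [div_add' _ _ _ hn'.ne', div_le_div_iff_of_pos_right hn']
      linarith
    have hlim : Tendsto (fun n : ℕ => (Real.log 2 + Real.log K) / n
        + (Real.log lam + 2 * ε * a)) atTop (nhds (0 + (Real.log lam + 2 * ε * a))) :=
      (tendsto_const_div_atTop_nhds_zero_nat _).add tendsto_const_nhds
    rw [zero_add] at hlim
    exact le_of_tendsto_of_tendsto hh hlim hbound
  -- Dividing by `a + 1` also covers `a = 0`, a one-letter alphabet.
  refine le_of_forall_pos_le_add fun δ hδ => (key (δ / (2 * (a + 1))) (by positivity)).trans ?_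
  have : 2 * (δ / (2 * (a + 1))) * a = δ * (a / (a + 1)) := by field_simp
  rw [this]
  have h2 : a / (a + 1) ≤ 1 := (div_le_one (by positivity)).2 (by linarith)
  have := mul_le_mul_of_nonneg_left h2 hδ.le
  linarith

end Entropy
open scoped ENNReal

/-! ### Independent sequences of code words -/

section Bernoulli

variable {ι : Type*} [MeasurableSpace ι] (p : PMF ι)

/-- The law of a bi-infinite sequence of independent letters with distribution `p`. -/
noncomputable def bernoulli : Measure (ℤ → ι) := Measure.infinitePi fun _ => p.toMeasure

instance : IsProbabilityMeasure (bernoulli p) := by unfold bernoulli; infer_instance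

theorem bernoulli_natBox [DiscreteMeasurableSpace ι] (n : ℕ) (s : ℕ → Set ι) :
    bernoulli p {ω | ∀ t < n, ω (t : ℕ) ∈ s t} = ∏ t ∈ Finset.range n, p.toMeasure (s t) := by
  have h := Measure.infinitePi_pi (μ := fun _ : ℤ => p.toMeasure)
    (s := (Finset.range n).map Nat.castEmbedding) (t := fun i : ℤ => s i.toNat)
    fun _ _ => MeasurableSet.of_discrete
  rw [Finset.prod_map] at h
  simp only [Nat.castEmbedding_apply, Int.toNat_natCast] at h
  rw [← h, bernoulli]
  congr 1
  ext ω
  simp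

theorem measurePreserving_bernoulli :
    MeasurePreserving (fun (ω : ℤ → ι) i => ω (i + 1)) (bernoulli p) (bernoulli p) := by
  refine ⟨measurable_pi_lambda _ fun i => measurable_pi_apply (i + 1), ?_⟩
  refine Measure.eq_infinitePi _ fun s t ht => ?_
  rw [Measure.map_apply (measurable_pi_lambda _ fun i => measurable_pi_apply (i + 1))
    (MeasurableSet.pi s.countable_toSet fun i hi => ht i)]
  have h := Measure.infinitePi_pi (μ := fun _ : ℤ => p.toMeasure)
    (s := s.map (Equiv.addRight (1 : ℤ)).toEmbedding) (t := fun i : ℤ => t (i - 1))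
    fun i _ => ht _
  rw [Finset.prod_map] at h
  simp only [Equiv.coe_toEmbedding, Equiv.coe_addRight, add_sub_cancel_right] at h
  rw [← h, bernoulli]
  congr 1
  ext ω
  simp only [Set.mem_preimage, Set.mem_pi, Finset.mem_coe, Finset.mem_map_equiv]
  constructor
  · intro hω i hi
    simpa [sub_eq_add_neg] using hω _ hi
  · intro hω i hi
    simpa using hω (i + 1) (by simpa using hi)

end Bernoulli

theorem measurable_lengths {A ι : Type*} {c : ι → List A} [MeasurableSpace ι]
    [DiscreteMeasurableSpace ι] (i : ℤ) : Measurable fun ω : ℤ → ι => lengths c ω i :=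
  (Measurable.of_discrete (f := fun g => (c g).length)).comp (measurable_pi_apply i)

/-! ### The shift-invariant measure over the Bernoulli base -/

section Tower

variable {A ι : Type*} {c : ι → List A} (hc : ∀ g, c g ≠ []) [MeasurableSpace ι]
  [MeasurableSpace A] (p : PMF ι)

/-- The law of the concatenation of independent code words, translated over the extent of the word
at the origin. Its mass is the mean length of a code word. -/
noncomputable def tower : Measure (ℤ → A) :=
  Measure.sum fun j : ℕ => ((bernoulli p).restrict {ω | j < lengths c ω 0}).map
    fun ω => translate j (coding hc ω)

variable [DiscreteMeasurableSpace ι]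

variable [Countable ι] [Countable A]

theorem measurable_translate_coding (t : ℤ) :
    Measurable fun ω => translate t (coding hc ω) :=
  (measurable_translate t).comp (measurable_coding hc)

theorem tower_apply {B : Set (ℤ → A)} (hB : MeasurableSet B) :
    tower hc p B = ∑' j : ℕ, bernoulli p
      {ω | j < lengths c ω 0 ∧ translate j (coding hc ω) ∈ B} := by
  rw [tower, Measure.sum_apply _ hB]
  refine tsum_congr fun j => ?_
  rw [Measure.map_apply (measurable_translate_coding hc j) hB,
    Measure.restrict_apply (measurable_translate_coding hc j hB)]
  congr 1
  ext ω
  simp [and_comm]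

theorem measurableSet_lengths_coding (P : ℕ → Prop) (t : ℤ) {B : Set (ℤ → A)}
    (hB : MeasurableSet B) :
    MeasurableSet {ω | P (lengths c ω 0) ∧ translate t (coding hc ω) ∈ B} :=
  (measurable_lengths 0 (MeasurableSet.of_discrete (s := {n | P n}))).inter
    (measurable_translate_coding hc t hB)

/-- The shift moves level `j` to level `j + 1`, except at the top of a word, where it returns to the
base. The returning part has the mass of the base level because the Bernoulli measure is invariant.
-/
theorem tower_preimage_shift {B : Set (ℤ → A)} (hB : MeasurableSet B) :
    tower hc p (shift ⁻¹' B) = tower hc p B := by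
  rw [tower_apply hc p hB, tsum_eq_zero_add' ENNReal.summable,
    tower_apply hc p (measurable_shift hB)]
  have h1 : ∀ j : ℕ, bernoulli p
      {ω | j < lengths c ω 0 ∧ translate j (coding hc ω) ∈ shift ⁻¹' B}
      = bernoulli p {ω | lengths c ω 0 = j + 1 ∧ translate (j + 1 : ℕ) (coding hc ω) ∈ B}
        + bernoulli p {ω | j + 1 < lengths c ω 0 ∧ translate (j + 1 : ℕ) (coding hc ω) ∈ B} := by
    intro j
    rw [← measure_union _ (measurableSet_lengths_coding hc (fun n => j + 1 < n) _ hB)]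
    · congr 1
      ext ω
      have e : shift (translate j (coding hc ω)) = translate (j + 1 : ℕ) (coding hc ω) := by
        funext i
        simp only [shift, translate]
        push_cast
        congr 1; ring
      simp only [Set.mem_ofPred_eq, Set.mem_preimage, e, Set.mem_union, ← or_and_right]
      refine and_congr_left fun _ => ?_
      omega
    · rw [Set.disjoint_left]
      rintro ω ⟨h, -⟩ ⟨h', -⟩
      omega
  simp only [h1]
  rw [ENNReal.tsum_add]
  congr 1
  rw [← measure_iUnion _ fun j => measurableSet_lengths_coding hc (fun n => n = j + 1) _ hB]
  -- The tops of words of all lengths together: stepping past the word at the origin shifts the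
  -- sequence of code words.
  · have e : ⋃ j : ℕ, {ω | lengths c ω 0 = j + 1 ∧ translate (j + 1 : ℕ) (coding hc ω) ∈ B}
        = (fun (ω : ℤ → ι) i => ω (i + 1)) ⁻¹' (coding hc ⁻¹' B) := by
      ext ω
      have := lengths_pos hc ω 0
      simp only [Set.mem_iUnion, Set.mem_ofPred_eq, Set.mem_preimage, ← translate_coding]
      constructor
      · rintro ⟨j, h, h'⟩
        rwa [h]
      · intro h
        refine ⟨lengths c ω 0 - 1, by omega, ?_⟩
        rwa [Nat.sub_add_cancel this]
    rw [e, (measurePreserving_bernoulli p).measure_preimage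
      (measurable_coding hc hB).nullMeasurableSet]
    congr 1
    ext ω
    have := lengths_pos hc ω 0
    have e0 : translate 0 (coding hc ω) = coding hc ω := by funext i; simp [translate]
    simp [this, e0]
  · intro i j hij
    rw [Function.onFun, Set.disjoint_left]
    rintro ω ⟨h, -⟩ ⟨h', -⟩
    omega

/-- Exchanging the sums counts a code word once for each of its places. -/
theorem tower_univ : tower hc p Set.univ = ∑' g, (c g).length * p g := by
  rw [tower_apply hc p MeasurableSet.univ]
  have h1 : ∀ j : ℕ, bernoulli p {ω | j < lengths c ω 0 ∧ translate j (coding hc ω) ∈ Set.univ}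
      = ∑' g, if j < (c g).length then p g else 0 := by
    intro j
    have h := bernoulli_natBox p 1 fun _ => {g | j < (c g).length}
    simp only [Nat.lt_one_iff, forall_eq, Finset.prod_range_one] at h
    rw [PMF.toMeasure_apply _ MeasurableSet.of_discrete] at h
    simp only [Set.mem_univ, and_true]
    refine Eq.trans h (tsum_congr fun g => ?_)
    simp [Set.indicator_apply]
  simp only [h1]
  rw [ENNReal.tsum_comm]
  refine tsum_congr fun g => ?_
  rw [tsum_eq_sum (s := Finset.range (c g).length) fun j hj => by simp_all]
  rw [Finset.sum_congr rfl fun j hj => if_pos (Finset.mem_range.1 hj)]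
  simp

theorem tower_compl_seqSet (hmeas : MeasurableSet (seqSet (Set.range c))) :
    tower hc p (seqSet (Set.range c))ᶜ = 0 := by
  rw [tower_apply hc p hmeas.compl]
  simp only [ENNReal.tsum_eq_zero]
  intro j
  convert measure_empty (μ := bernoulli p)
  rw [Set.eq_empty_iff_forall_notMem]
  rintro ω ⟨-, h⟩
  exact h ⟨_, (isRepresentation_coding hc ω).translate j⟩

theorem one_le_tower_univ : 1 ≤ tower hc p Set.univ := by
  rw [tower_univ, ← p.tsum_coe]
  refine ENNReal.tsum_le_tsum fun g => le_mul_of_one_le_left' ?_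
  exact_mod_cast List.length_pos_iff.2 (hc g)

/-- The stationary law of the concatenation of independent code words. -/
noncomputable def stationary : Measure (ℤ → A) := (tower hc p Set.univ)⁻¹ • tower hc p

theorem isProbabilityMeasure_stationary (hp : ∑' g, (c g).length * p g ≠ ∞) :
    IsProbabilityMeasure (stationary hc p) := by
  constructor
  rw [stationary, Measure.smul_apply, smul_eq_mul, ENNReal.inv_mul_cancel]
  · exact (zero_lt_one.trans_le (one_le_tower_univ hc p)).ne'
  · rwa [tower_univ]

theorem measurePreserving_stationary :
    MeasurePreserving shift (stationary hc p) (stationary hc p) := by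
  refine ⟨measurable_shift, ?_⟩
  rw [stationary, Measure.map_smul]
  congr 1
  ext B hB
  rw [Measure.map_apply measurable_shift hB, tower_preimage_shift hc p hB]

theorem stationary_compl_seqSet (hmeas : MeasurableSet (seqSet (Set.range c))) :
    stationary hc p (seqSet (Set.range c))ᶜ = 0 := by
  simp [stationary, tower_compl_seqSet hc p hmeas]

/-- No code word is empty, so the tower has mass at least `1` and normalizing only decreases it.
Cylinder bounds carry over unchanged. -/
theorem stationary_le_tower (B : Set (ℤ → A)) : stationary hc p B ≤ tower hc p B := by
  rw [stationary, Measure.smul_apply, smul_eq_mul]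
  exact mul_le_of_le_one_left' (ENNReal.inv_le_one.2 (one_le_tower_univ hc p))

end Tower

/-! ### Measures of cylinders -/

section CylinderBound

variable {A ι : Type*} {c : ι → List A} (hc : ∀ g, c g ≠ []) {p : PMF ι} {q d : ℝ≥0∞}

/-- A geometric tail. In `ℝ≥0∞` no assumption `q < 1` is needed, since the factor `(1 - q)⁻¹` may be
infinite. -/
theorem toMeasure_length_ge_le [MeasurableSpace ι]
    (hd : ∀ r, p.toMeasure {g | (c g).length = r} ≤ d * q ^ r) (r : ℕ) :
    p.toMeasure {g | r ≤ (c g).length} ≤ d * (1 - q)⁻¹ * q ^ r := by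
  have hsub : {g | r ≤ (c g).length} ⊆ ⋃ s : ℕ, {g | (c g).length = r + s} := fun g hg =>
    Set.mem_iUnion.2 ⟨(c g).length - r, (Nat.add_sub_of_le hg).symm⟩
  calc p.toMeasure {g | r ≤ (c g).length}
      ≤ ∑' s : ℕ, p.toMeasure {g | (c g).length = r + s} :=
        (measure_mono hsub).trans (measure_iUnion_le _)
    _ ≤ ∑' s : ℕ, d * q ^ r * q ^ s := ENNReal.tsum_le_tsum fun s =>
        (hd (r + s)).trans_eq (by rw [pow_add, mul_assoc])
    _ = d * (1 - q)⁻¹ * q ^ r := by rw [ENNReal.tsum_mul_left, ENNReal.tsum_geometric]; ring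

/-- After a code word comes a concatenation of code words that spells `u[i, i + l)`, and then
a code word of length at least `n - i - l`. -/
def spells {n : ℕ} (u : Fin n → A) (i l : ℕ) : Set (ℤ → ι) :=
  {ω | ∃ m : ℕ, cut (lengths c ω) m = l ∧ n - i - l ≤ lengths c ω m ∧
    ∀ t : ℕ, t < l → ∀ h : i + t < n, coding hc ω t = u ⟨i + t, h⟩}

/-- Two members spell the same word between cuts at `0` and `l`, so by `UniquelyRepresents.cuts_eq`
they use the same code words there. Any one member thus prescribes them for all, and the event lies
in a product box. -/
theorem spells_subset (hinj : Function.Injective c) (hG : UniquelyRepresents (Set.range c))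
    {n : ℕ} (u : Fin n → A) {i l : ℕ} (hil : i + l ≤ n)
    (hne : (spells hc u i l).Nonempty) :
    ∃ (m : ℕ) (g : ℕ → ι), ∑ t ∈ Finset.range m, (c (g t)).length = l ∧
      spells hc u i l ⊆ {ω | (∀ t : ℕ, t < m → ω t = g t) ∧ n - i - l ≤ lengths c ω m} := by
  obtain ⟨ω', m', hm', -, hu'⟩ := hne
  refine ⟨m', fun t => ω' t, ?_, ?_⟩
  · rw [cut_natCast] at hm'
    exact_mod_cast hm'
  · rintro ω ⟨m, hm, hlen, hu⟩
    have hxy : ∀ t : ℤ, 0 ≤ t → t < l → coding hc ω t = coding hc ω' t := by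
      intro t h0 hl
      lift t to ℕ using h0
      have hl' : t < l := by exact_mod_cast hl
      rw [hu t hl' (by omega), hu' t hl' (by omega)]
    obtain ⟨rfl, hcut⟩ := hG.cuts_eq (isRepresentation_coding hc ω)
      (isRepresentation_coding hc ω') (cut_zero _) (cut_zero _) hm hm' hxy
    refine ⟨fun t ht => hinj ?_, hlen⟩
    have h1 := hcut t ht.le
    have h2 := hcut (t + 1) ht
    push_cast at h2
    rw [← word_coding hc ω, ← word_coding hc ω', ← h1, ← h2]
    refine word_congr fun s hs1 hs2 => hxy s ?_ (hs2.trans_le ?_)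
    · have := (cut_strictMono (lengths_pos hc ω)).monotone (show (0 : ℤ) ≤ t by omega)
      rw [cut_zero] at this
      exact this.trans hs1
    · rw [← hm]
      exact (cut_strictMono (lengths_pos hc ω)).monotone (by omega)

/-- Either the word at the origin covers the whole window of length `n`, or its last `i` letters
open the window, whole code words of total length `l` follow, and one more word reaches the end of
the window. -/
theorem level_subset {n : ℕ} (u : Fin n → A) (j : ℕ) :
    {ω | j < lengths c ω 0 ∧ translate j (coding hc ω) ∈ block n ⁻¹' {u}}
      ⊆ {ω | n + j ≤ lengths c ω 0} ∪ ⋃ i ∈ Finset.range (n + 1), ⋃ l ∈ Finset.range (n + 1 - i),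
        {ω | lengths c ω 0 = i + j ∧ (fun i => ω (i + 1)) ∈ spells hc u i l} := by
  rintro ω ⟨hj, hu⟩
  by_cases hlen : n + j ≤ lengths c ω 0
  · exact Or.inl hlen
  refine Or.inr ?_
  set ω' : ℤ → ι := fun i => ω (i + 1) with hω'
  obtain ⟨i, hi⟩ : ∃ i, lengths c ω 0 = i + j := ⟨lengths c ω 0 - j, by omega⟩
  have hmono := cut_strictMono (lengths_pos hc ω')
  -- The word of index `m` contains the first place after the window, so the words before it lie
  -- inside the window.
  obtain ⟨m, h1, h2⟩ := StrictMono.exists_mem_Ico hmono ((n : ℤ) - i)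
  have hm : 0 ≤ m := by
    have : (0 : ℤ) < m + 1 := hmono.lt_iff_lt.1 (by rw [cut_zero]; omega)
    omega
  lift m to ℕ using hm
  have h0 : 0 ≤ cut (lengths c ω') m := by
    have := hmono.monotone (show (0 : ℤ) ≤ m by omega)
    rwa [cut_zero] at this
  obtain ⟨l, hl⟩ := Int.eq_ofNat_of_zero_le h0
  rw [cut_add_one] at h2
  simp only [Set.mem_iUnion]
  have hlen' : n - i - l ≤ lengths c ω' m := by omega
  refine ⟨i, Finset.mem_range.2 (by omega), l, Finset.mem_range.2 (by omega), hi, m, hl,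
    hlen', fun t _ h => ?_⟩
  rw [← translate_coding hc ω, hi, ← (hu : block n (translate j (coding hc ω)) = u)]
  simp only [translate, block]
  push_cast
  congr 1; ring

variable [MeasurableSpace ι] [DiscreteMeasurableSpace ι]

theorem bernoulli_spells_le (hinj : Function.Injective c) (hG : UniquelyRepresents (Set.range c))
    (hp : ∀ g, p g = q ^ (c g).length)
    (hd : ∀ r, p.toMeasure {g | (c g).length = r} ≤ d * q ^ r)
    {n : ℕ} (u : Fin n → A) {i l : ℕ} (hil : i + l ≤ n) (j : ℕ) :
    bernoulli p {ω | lengths c ω 0 = i + j ∧ (fun i => ω (i + 1)) ∈ spells hc u i l}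
      ≤ d * (d * (1 - q)⁻¹) * q ^ n * q ^ j := by
  rcases (spells hc u i l).eq_empty_or_nonempty with he | hne
  · simp [he]
  obtain ⟨m, g, hg, hsub⟩ := spells_subset hc hinj hG u hil hne
  -- Coordinate `0` is the word at the origin, of exact length `i + j`. Coordinates `1, …, m` are
  -- prescribed, and coordinate `m + 1` is the last word, of which only a minimal length is known.
  -- The exponents of `q` add up to `n + j`.
  set s : ℕ → Set ι := fun t => if t = 0 then {a | (c a).length = i + j} else
    if t = m + 1 then {a | n - i - l ≤ (c a).length} else {g (t - 1)} with hs
  have h1 : {ω | lengths c ω 0 = i + j ∧ (fun i => ω (i + 1)) ∈ spells hc u i l}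
      ⊆ {ω | ∀ t < m + 1 + 1, ω (t : ℕ) ∈ s t} := by
    rintro ω ⟨h0, hω⟩ t ht
    obtain ⟨h2, h3⟩ := hsub hω
    rcases t with _ | t
    · simpa [hs, lengths] using h0
    · rcases (show t ≤ m by omega).eq_or_lt with rfl | htm
      · simpa [hs, lengths] using h3
      · have := h2 t htm
        simpa [hs, htm.ne] using this
  refine (measure_mono h1).trans ?_
  rw [bernoulli_natBox, Finset.prod_range_succ, Finset.prod_range_succ']
  have e1 : ∏ t ∈ Finset.range m, p.toMeasure (s (t + 1)) = q ^ l := by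
    rw [← hg, ← Finset.prod_pow_eq_pow_sum]
    refine Finset.prod_congr rfl fun t ht => ?_
    have : t ≠ m := (Finset.mem_range.1 ht).ne
    simp [hs, this, PMF.toMeasure_apply_singleton, hp]
  have e2 : p.toMeasure (s 0) ≤ d * q ^ (i + j) := by simpa [hs] using hd (i + j)
  have e3 : p.toMeasure (s (m + 1)) ≤ d * (1 - q)⁻¹ * q ^ (n - i - l) := by
    simpa [hs] using toMeasure_length_ge_le hd (n - i - l)
  rw [e1]
  calc _ ≤ q ^ l * (d * q ^ (i + j)) * (d * (1 - q)⁻¹ * q ^ (n - i - l)) := by gcongr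
    _ = d * (d * (1 - q)⁻¹) * (q ^ l * q ^ i * q ^ (n - i - l)) * q ^ j := by ring
    _ = _ := by rw [← pow_add, ← pow_add, show l + i + (n - i - l) = n by omega]

variable [Countable ι] [MeasurableSpace A] [Countable A] [MeasurableSingletonClass A]

/-- At most `(n + 1)²` pairs `(i, l)` occur on each level. The factor `q ^ j` makes the sum over the
levels geometric, which gives the second `(1 - q)⁻¹`. -/
theorem tower_block_le (hinj : Function.Injective c) (hG : UniquelyRepresents (Set.range c))
    (hp : ∀ g, p g = q ^ (c g).length)
    (hd : ∀ r, p.toMeasure {g | (c g).length = r} ≤ d * q ^ r) {n : ℕ} (u : Fin n → A) :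
    tower hc p (block n ⁻¹' {u})
      ≤ d * (1 - q)⁻¹ * (1 + d) * (1 - q)⁻¹ * ((n + 1) ^ 2 * q ^ n) := by
  rw [tower_apply hc p (measurable_block n (measurableSet_singleton u))]
  have key : ∀ j : ℕ,
      bernoulli p {ω | j < lengths c ω 0 ∧ translate j (coding hc ω) ∈ block n ⁻¹' {u}}
      ≤ d * (1 - q)⁻¹ * (1 + d) * ((n + 1) ^ 2 * q ^ n) * q ^ j := by
    intro j
    have e1 : bernoulli p {ω | n + j ≤ lengths c ω 0} ≤ d * (1 - q)⁻¹ * q ^ (n + j) := by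
      have h := bernoulli_natBox p 1 fun _ => {g | n + j ≤ (c g).length}
      simp only [Nat.lt_one_iff, forall_eq, Finset.prod_range_one] at h
      exact h.trans_le (toMeasure_length_ge_le hd _)
    have e2 : bernoulli p (⋃ i ∈ Finset.range (n + 1), ⋃ l ∈ Finset.range (n + 1 - i),
        {ω | lengths c ω 0 = i + j ∧ (fun i => ω (i + 1)) ∈ spells hc u i l})
        ≤ (n + 1) ^ 2 * (d * (d * (1 - q)⁻¹) * q ^ n * q ^ j) := by
      calc _ ≤ ∑ i ∈ Finset.range (n + 1), ∑ l ∈ Finset.range (n + 1 - i), bernoulli p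
            {ω | lengths c ω 0 = i + j ∧ (fun i => ω (i + 1)) ∈ spells hc u i l} :=
            (measure_biUnion_finset_le _ _).trans
              (Finset.sum_le_sum fun i _ => measure_biUnion_finset_le _ _)
        _ ≤ ∑ i ∈ Finset.range (n + 1), ∑ l ∈ Finset.range (n + 1),
            d * (d * (1 - q)⁻¹) * q ^ n * q ^ j := by
            refine Finset.sum_le_sum fun i hi => (Finset.sum_le_sum fun l hl => ?_).trans
              (Finset.sum_le_sum_of_subset (Finset.range_mono (by omega)))
            simp only [Finset.mem_range] at hi hl
            exact bernoulli_spells_le hc hinj hG hp hd u (by omega) j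
        _ = _ := by simp; ring
    refine (measure_mono (level_subset hc u j)).trans ((measure_union_le _ _).trans
      ((add_le_add e1 e2).trans ?_))
    have h1 : (1 : ℝ≥0∞) ≤ (n + 1) ^ 2 := one_le_pow₀ (by simp)
    calc _ ≤ (n + 1) ^ 2 * (d * (1 - q)⁻¹ * q ^ (n + j))
          + (n + 1) ^ 2 * (d * (d * (1 - q)⁻¹) * q ^ n * q ^ j) := by
          exact add_le_add_left (le_mul_of_one_le_left' h1) _
      _ = _ := by rw [pow_add]; ring
  refine (ENNReal.tsum_le_tsum key).trans_eq ?_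
  rw [ENNReal.tsum_mul_left, ENNReal.tsum_geometric]
  ring

end CylinderBound

/-! ### From cylinder bounds to a lower bound for the entropy -/

section LowerBound

theorem tendsto_log_add_one_div_atTop :
    Tendsto (fun n : ℕ => Real.log ((n : ℝ) + 1) / n) atTop (nhds 0) := by
  have h1 : Tendsto (fun n : ℕ => Real.log ((n : ℝ) + 1) / ((n : ℝ) + 1)) atTop (nhds 0) := by
    have := (Real.isLittleO_log_id_atTop.tendsto_div_nhds_zero).comp
      (tendsto_natCast_atTop_atTop (R := ℝ) |>.comp (tendsto_add_atTop_nat 1))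
    refine this.congr fun n => ?_
    simp
  have h2 : Tendsto (fun n : ℕ => ((n : ℝ) + 1) / n) atTop (nhds 1) := by
    have := (tendsto_const_nhds (x := (1 : ℝ))).add tendsto_one_div_atTop_nhds_zero_nat
    rw [add_zero] at this
    refine this.congr' ?_
    filter_upwards [eventually_gt_atTop 0] with n hn
    have : (n : ℝ) ≠ 0 := by positivity
    field_simp
  have := h1.mul h2
  rw [zero_mul] at this
  refine this.congr fun n => ?_
  have : (n : ℝ) + 1 ≠ 0 := by positivity
  field_simp

variable {A : Type*} [MeasurableSpace A] [Fintype A] [MeasurableSingletonClass A]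

/-- If the measures of cylinders are at most `K (n + 1)² λ⁻ⁿ`, the entropy is at least `log λ`. -/
theorem log_le_entropy {μ : Measure (ℤ → A)} [IsProbabilityMeasure μ] {K lam : ℝ} (hK : 0 < K)
    (hlam : 0 < lam) (hμ : ∀ (n : ℕ) (u : Fin n → A),
      μ.real (block n ⁻¹' {u}) ≤ K * ((n + 1) ^ 2 * lam⁻¹ ^ n)) {h : ℝ}
    (hh : Tendsto (fun n : ℕ => shannon μ (block (A := A) n) / n) atTop (nhds h)) :
    Real.log lam ≤ h := by
  have hlim : Tendsto (fun n : ℕ => Real.log lam - (Real.log K / n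
      + 2 * (Real.log ((n : ℝ) + 1) / n))) atTop (nhds (Real.log lam - (0 + 2 * 0))) :=
    tendsto_const_nhds.sub ((tendsto_const_div_atTop_nhds_zero_nat _).add
      (tendsto_log_add_one_div_atTop.const_mul 2))
  rw [mul_zero, add_zero, sub_zero] at hlim
  refine le_of_tendsto_of_tendsto hlim hh ?_
  filter_upwards [eventually_gt_atTop 0] with n hn
  have hn' : (0 : ℝ) < n := by exact_mod_cast hn
  have h1 := le_shannon_of_fiber_le μ (measurable_block n) (hμ n)
  rw [Real.log_mul (by positivity) (by positivity), Real.log_mul (by positivity) (by positivity),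
    Real.log_pow, Real.log_pow, Real.log_inv] at h1
  have h2 : Real.log lam - (Real.log K / n + 2 * (Real.log ((n : ℝ) + 1) / n))
      = (Real.log lam * n - (Real.log K + 2 * Real.log ((n : ℝ) + 1))) / n := by field_simp
  rw [h2, div_le_div_iff_of_pos_right hn']
  push_cast at h1
  linarith

end LowerBound

/-! ### The equation for `λ` -/

section Root

variable {ι : Type*} {len : ι → ℕ} {d : ℕ}

theorem tsum_comp_le_of_card_fiber_le (hd : ∀ n, ENat.card {g // len g = n} ≤ d) (F : ℕ → ℝ≥0∞) :
    ∑' g, F (len g) ≤ d * ∑' n, F n := by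
  rw [← (Equiv.sigmaFiberEquiv len).tsum_eq, ENNReal.tsum_sigma', ← ENNReal.tsum_mul_left]
  refine ENNReal.tsum_le_tsum fun n => ?_
  have : ∀ x : {g // len g = n}, F (len ((Equiv.sigmaFiberEquiv len) ⟨n, x⟩)) = F n := fun x =>
    congrArg F x.2
  simp only [this]
  rw [ENNReal.tsum_const]
  gcongr
  exact_mod_cast ENat.toENNReal_mono (hd n)

theorem summable_pow_of_card_fiber_le (hd : ∀ n, ENat.card {g // len g = n} ≤ d) {q : ℝ}
    (hq0 : 0 ≤ q) (hq1 : q < 1) : Summable fun g => q ^ len g := by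
  have h := tsum_comp_le_of_card_fiber_le hd fun n => ENNReal.ofReal (q ^ n)
  have h2 := (summable_geometric_of_lt_one hq0 hq1).tsum_ofReal_ne_top
  have h3 := ENNReal.summable_toReal (h.trans_lt (ENNReal.mul_lt_top (by simp) h2.lt_top)).ne
  refine h3.congr fun g => ?_
  rw [ENNReal.toReal_ofReal (by positivity)]

/-- The generating function of a set of code words takes the value `1` on `(0, 1]`, and it does so
on `(0, 1)` unless there is only one code word. -/
theorem exists_hasSum_pow_eq_one [Nonempty ι] (hlen : ∀ g, 0 < len g)
    (hd : ∀ n, ENat.card {g // len g = n} ≤ d) :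
    ∃ q : ℝ, 0 < q ∧ HasSum (fun g => q ^ len g) 1 ∧ (q < 1 ∨ q = 1 ∧ Subsingleton ι) := by
  classical
  rcases subsingleton_or_nontrivial ι with hι | hι
  · refine ⟨1, one_pos, ?_, Or.inr ⟨rfl, hι⟩⟩
    have : Unique ι := uniqueOfSubsingleton (Classical.arbitrary ι)
    simp
  obtain ⟨g, h, hgh⟩ := exists_pair_ne ι
  -- Two words alone contribute a sum tending to `2` as `t` tends to `1`, so it exceeds `1` at some
  -- `t < 1`, where the full series still converges.
  obtain ⟨t, ⟨ht1, ht0⟩, htlt⟩ : ∃ t : ℝ, (1 < t ^ len g + t ^ len h ∧ 0 < t) ∧ t < 1 := by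
    have hcont : Tendsto (fun t : ℝ => t ^ len g + t ^ len h) (nhdsWithin 1 (Set.Iio 1))
        (nhds (1 ^ len g + 1 ^ len h)) :=
      (Continuous.tendsto (by fun_prop) 1).mono_left nhdsWithin_le_nhds
    have h1 := hcont.eventually (lt_mem_nhds (show (1 : ℝ) < 1 ^ len g + 1 ^ len h by norm_num))
    have h2 : ∀ᶠ t : ℝ in nhdsWithin 1 (Set.Iio 1), 0 < t :=
      nhdsWithin_le_nhds (lt_mem_nhds one_pos)
    exact ((h1.and h2).and self_mem_nhdsWithin).exists
  have hsum := summable_pow_of_card_fiber_le hd ht0.le htlt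
  have hcont : ContinuousOn (fun q : ℝ => ∑' g, q ^ len g) (Set.Icc 0 t) := by
    refine continuousOn_tsum (fun g => by fun_prop) hsum fun g q hq => ?_
    rw [Real.norm_of_nonneg (pow_nonneg hq.1 _)]
    exact pow_le_pow_left₀ hq.1 hq.2 _
  have hzero : ∑' g, (0 : ℝ) ^ len g = 0 := by simp [fun g => (hlen g).ne']
  have hone : 1 ≤ ∑' g, t ^ len g := by
    have := hsum.sum_le_tsum {g, h} fun _ _ => by positivity
    rw [Finset.sum_pair hgh] at this
    linarith
  obtain ⟨q, ⟨hq0, hqt⟩, hq⟩ := intermediate_value_Icc ht0.le hcont ⟨hzero.trans_le zero_le_one, hone⟩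
  have hq1 : q < 1 := hqt.trans_lt htlt
  refine ⟨q, hq0.lt_of_ne ?_, ?_, Or.inl hq1⟩
  · rintro rfl
    simp only [hzero] at hq
    exact zero_ne_one hq
  · exact hq ▸ (summable_pow_of_card_fiber_le hd hq0 hq1).hasSum

/-- The series is strictly increasing in its base, term by term. -/
theorem eq_of_hasSum_pow [Nonempty ι] (hlen : ∀ g, 0 < len g) {q q' : ℝ} (hq : 0 < q)
    (hq' : 0 < q') (h : HasSum (fun g => q ^ len g) 1) (h' : HasSum (fun g => q' ^ len g) 1) :
    q = q' := by
  have key : ∀ a b : ℝ, 0 < a → HasSum (fun g => a ^ len g) 1 → HasSum (fun g => b ^ len g) 1 →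
      ¬ a < b := by
    intro a b ha hA hB hab
    obtain ⟨g⟩ := ‹Nonempty ι›
    exact (hasSum_lt (fun g => pow_le_pow_left₀ ha.le hab.le (len g))
      (pow_lt_pow_left₀ hab ha.le (hlen g).ne') hA hB).false
  exact le_antisymm (not_lt.1 (key q' q hq' h' h)) (not_lt.1 (key q q' hq h h'))

/-- The mean length of a code word is finite, so the tower can be normalized. -/
theorem tsum_length_mul_pow_ne_top (hd : ∀ n, ENat.card {g // len g = n} ≤ d) {q : ℝ}
    (hq0 : 0 < q) (hq1 : q < 1 ∨ q = 1 ∧ Subsingleton ι) :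
    ∑' g, len g * ENNReal.ofReal q ^ len g ≠ ∞ := by
  rcases hq1 with hq1 | ⟨-, hι⟩
  · have h := tsum_comp_le_of_card_fiber_le hd fun n => n * ENNReal.ofReal q ^ n
    have h2 := (summable_pow_mul_geometric_of_norm_lt_one 1
      (show ‖q‖ < 1 by rwa [Real.norm_of_nonneg hq0.le])).tsum_ofReal_ne_top
    have h3 : ∀ n : ℕ, ENNReal.ofReal ((n : ℝ) ^ 1 * q ^ n) = n * ENNReal.ofReal q ^ n := fun n => by
      rw [pow_one, ENNReal.ofReal_mul (by positivity), ENNReal.ofReal_natCast,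
        ENNReal.ofReal_pow hq0.le]
    simp only [h3] at h2
    exact (h.trans_lt (ENNReal.mul_lt_top (by simp) h2.lt_top)).ne
  · have := Finite.of_subsingleton (α := ι)
    have := Fintype.ofFinite ι
    rw [tsum_fintype]
    exact (ENNReal.sum_lt_top.2 fun g _ => ENNReal.mul_lt_top (by simp)
      (ENNReal.pow_lt_top ENNReal.ofReal_lt_top)).ne

end Root

/-! ### The sequential entropy -/

section SeqEntropy

variable {A ι : Type*} {c : ι → List A} [TopologicalSpace A]

theorem subset_codedShift (G : Set (List A)) : seqSet G ⊆ codedShift G := subset_closure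

variable [Finite A] [MeasurableSpace A] [MeasurableSingletonClass A] [Countable ι]

theorem seqEntropy_eq_log (hinj : Function.Injective c) (hc : ∀ g, c g ≠ [])
    (hG : UniquelyRepresents (Set.range c)) {d : ℕ}
    (hd : ∀ n, ENat.card {g // (c g).length = n} ≤ d) {q : ℝ} (hq0 : 0 < q)
    (hsum : HasSum (fun g => q ^ (c g).length) 1) (hq1 : q < 1 ∨ q = 1 ∧ Subsingleton ι) :
    seqEntropy (Set.range c) = ((Real.log q⁻¹ : ℝ) : EReal) := by
  let : MeasurableSpace ι := ⊤
  have := Fintype.ofFinite A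
  have hmeas : MeasurableSet (seqSet (Set.range c)) := measurableSet_seqSet hc hinj hG
  have hq1' : 1 ≤ q⁻¹ := (one_le_inv₀ hq0).2 (hq1.elim le_of_lt fun h => h.1.le)
  have hsum' : HasSum (fun g => q⁻¹⁻¹ ^ (c g).length) 1 := by rwa [inv_inv]
  have hcompl : ∀ μ : Measure (ℤ → A), μ (seqSet (Set.range c))ᶜ = 0 →
      μ (codedShift (Set.range c))ᶜ = 0 := fun μ =>
    measure_mono_null (Set.compl_subset_compl.2 (subset_codedShift _))
  refine le_antisymm (iSup₂_le ?_) ?_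
  · rintro μ ⟨⟨hprob, hinv, -⟩, hμ⟩
    exact EReal.coe_le_coe_iff.2 (entropy_le_log hc hinj hG hq1' hsum' hinv hμ
      (tendsto_shannon_block_entropy _ μ hinv (hcompl μ ((prob_compl_eq_zero_iff hmeas).2 hμ))))
  -- The equation for `λ` says exactly that these weights have sum `1`.
  · set p : PMF ι := ⟨fun g => ENNReal.ofReal q ^ (c g).length, by
      rw [ENNReal.summable.hasSum_iff]
      simp only [← ENNReal.ofReal_pow hq0.le]
      rw [← ENNReal.ofReal_tsum_of_nonneg (fun g => by positivity) hsum.summable, hsum.tsum_eq,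
        ENNReal.ofReal_one]⟩
    have hp : ∀ g, p g = ENNReal.ofReal q ^ (c g).length := fun g => rfl
    set μ := stationary hc p with hμ
    have hprob : IsProbabilityMeasure μ := isProbabilityMeasure_stationary hc p (by
      simp only [hp]
      exact tsum_length_mul_pow_ne_top hd hq0 hq1)
    have hinv : MeasurePreserving shift μ μ := measurePreserving_stationary hc p
    have hnull : μ (seqSet (Set.range c))ᶜ = 0 := stationary_compl_seqSet hc p hmeas
    have hseq : μ (seqSet (Set.range c)) = 1 := (prob_compl_eq_zero_iff hmeas).1 hnull
    have hX : μ (codedShift (Set.range c)) = 1 :=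
      le_antisymm prob_le_one (hseq ▸ measure_mono (subset_codedShift _))
    have hh := tendsto_shannon_block_entropy _ μ hinv (hcompl μ hnull)
    refine le_iSup₂_of_le μ ⟨⟨hprob, hinv, hX⟩, hseq⟩ (EReal.coe_le_coe_iff.2 ?_)
    rcases hq1 with hq1 | ⟨rfl, -⟩
    · have hd' : ∀ r, p.toMeasure {g | (c g).length = r} ≤ d * ENNReal.ofReal q ^ r := by
        intro r
        rw [PMF.toMeasure_apply _ MeasurableSet.of_discrete, ← tsum_subtype]
        have : ∀ g : {g | (c g).length = r}, p g = ENNReal.ofReal q ^ r := fun g => by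
          rw [hp, show (c g).length = r from g.2]
        simp only [this]
        rw [ENNReal.tsum_const]
        gcongr
        exact_mod_cast ENat.toENNReal_mono (hd r)
      set K : ℝ≥0∞ := d * (1 - ENNReal.ofReal q)⁻¹ * (1 + d) * (1 - ENNReal.ofReal q)⁻¹
      have hinvtop : (1 - ENNReal.ofReal q)⁻¹ ≠ ∞ := by
        rw [ENNReal.inv_ne_top]
        exact (tsub_pos_of_lt (ENNReal.ofReal_lt_one.2 hq1)).ne'
      have hKtop : K ≠ ∞ := by
        refine ENNReal.mul_ne_top (ENNReal.mul_ne_top (ENNReal.mul_ne_top ?_ hinvtop) ?_) hinvtop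
          <;> simp
      have hcyl : ∀ (n : ℕ) (u : Fin n → A),
          μ (block n ⁻¹' {u}) ≤ K * ((n + 1) ^ 2 * ENNReal.ofReal q ^ n) := fun n u =>
        (stationary_le_tower hc p _).trans (tower_block_le hc hinj hG hp hd' u)
      clear_value K
      -- The summand `1` makes the constant positive without examining `K`.
      refine log_le_entropy (K := K.toReal + 1) (by positivity) (by positivity) (fun n u => ?_) hh
      have h2 : K * ((n + 1) ^ 2 * ENNReal.ofReal q ^ n) ≠ ∞ :=
        ENNReal.mul_ne_top hKtop (ENNReal.mul_ne_top (by simp) (by simp))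
      have h3 := ENNReal.toReal_mono h2 (hcyl n u)
      have h4 : ((n : ℝ≥0∞) + 1).toReal = n + 1 := by
        rw [ENNReal.toReal_add (by simp) (by simp)]; simp
      rw [ENNReal.toReal_mul, ENNReal.toReal_mul, ENNReal.toReal_pow, ENNReal.toReal_pow,
        ENNReal.toReal_ofReal hq0.le, h4] at h3
      rw [inv_inv, measureReal_def]
      refine h3.trans ?_
      gcongr
      linarith
    -- For `q = 1` the geometric factors are infinite and the cylinder bound is void, but the claim
    -- is only that entropy is nonnegative.
    · rw [inv_one, Real.log_one]
      exact ge_of_tendsto' hh fun n => div_nonneg (shannon_nonneg _ _) n.cast_nonneg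

end SeqEntropy
end CodedShift

/-! ### The theorem for a set of words, coded by its inclusion map -/

theorem mainTheorem8 {A : Type*} [Finite A] [TopologicalSpace A] [DiscreteTopology A]
    [MeasurableSpace A] [BorelSpace A] (G : Set (List A)) (hG : G.Nonempty)
    (hnil : [] ∉ G) (huniq : CodedShift.UniquelyRepresents G)
    (hbdd : ∃ d : ℕ, ∀ n : ℕ, {g : List A | g ∈ G ∧ g.length = n}.ncard ≤ d) :
    ∃ lam : ℝ, 0 < lam ∧
      HasSum (fun g : G => lam ^ (-((g : List A).length : ℤ))) 1 ∧
      (∀ lam' : ℝ, 0 < lam' →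
        HasSum (fun g : G => lam' ^ (-((g : List A).length : ℤ))) 1 → lam' = lam) ∧
      CodedShift.seqEntropy G = ((Real.log lam : ℝ) : EReal) := by
  obtain ⟨d, hd⟩ := hbdd
  have := hG.to_subtype
  have hc : ∀ g : G, (g : List A) ≠ [] := fun g h => hnil (h ▸ g.2)
  have hlen : ∀ g : G, 0 < (g : List A).length := fun g => List.length_pos_iff.2 (hc g)
  have hd' : ∀ n, ENat.card {g : G // (g : List A).length = n} ≤ d := by
    intro n
    -- `Set.ncard` is `0` on infinite sets, so the bound `hd` has content only because a finite
    -- alphabet has finitely many words of length `n`.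
    have hfin : {g : List A | g ∈ G ∧ g.length = n}.Finite :=
      (List.finite_length_eq A n).subset fun _ h => h.2
    have e : ENat.card {g : G // (g : List A).length = n}
        = {g : List A | g ∈ G ∧ g.length = n}.encard :=
      ENat.card_congr (Equiv.subtypeSubtypeEquivSubtypeInter (· ∈ G) fun g : List A => g.length = n)
    rw [e, ← hfin.cast_ncard_eq]
    exact_mod_cast hd n
  have hpow : ∀ (x : ℝ) (g : G),
      x ^ (-((g : List A).length : ℤ)) = x⁻¹ ^ (g : List A).length := fun x g => by
    rw [zpow_neg, zpow_natCast, inv_pow]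
  simp only [hpow]
  obtain ⟨q, hq0, hsum, hq1⟩ := CodedShift.exists_hasSum_pow_eq_one hlen hd'
  refine ⟨q⁻¹, inv_pos.2 hq0, by simpa only [inv_inv] using hsum, fun lam' h0 h => ?_, ?_⟩
  · rw [CodedShift.eq_of_hasSum_pow hlen hq0 (inv_pos.2 h0) hsum h, inv_inv]
  · have h := CodedShift.seqEntropy_eq_log (c := ((↑) : G → List A)) Subtype.val_injective hc
      (by rwa [Subtype.range_coe]) hd' hq0 hsum hq1
    rwa [Subtype.range_coe] at h
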